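/- **Setting.** Let $p\ge q$, $c\in\mathbb C$, and let $F$ be a constant real $p\times q$ matrix; let $E$ be the $p\times q$ matrix $E_{ij}=\delta_{ij}$. On $T^*SO(p)\ni(k,\ell)$, $k\in SO(p)$, $\ell\in so(p)$, take the canonical brackets $$\{\ell_{ij},\ell_{mn}\}=\delta_{in}\ell_{jm}+\delta_{jm}\ell_{in}-\delta_{im}\ell_{jn}-\delta_{jn}\ell_{im},\quad \{\ell_{ij},k_{nm}\}=\delta_{jm}k_{ni}-\delta_{im}k_{nj},\quad \{k_{ij},k_{mn}\}=0 .$$ For $k\in SO(p)$, $r\in SO(q)$, $\ell\in so(p)$, $m\in so(q)$ put $y=c\begin{pmatrix}0&F\\-F^T&0\end{pmatrix}$ and $$L(\lambda)=\lambda\begin{pmatrix}0&kEr^T\\ rE^Tk^T&0\end{pmatrix}-\begin{pmatrix}k\ell k^T&0\\0&rmr^T\end{pmatrix}+\lambda^{-1}\begin{pmatrix}0&F\\F^T&0\end{pmatrix},$$ $$L^{(2)}_y(\lambda)=(1-\lambda^{-1}y)^{-1}\left[L(\lambda)-c\begin{pmatrix}0&0\\0&rE^Tk^TF-F^TkEr^T\end{pmatrix}\right].$$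 Let $\hat L_y(\lambda)=(1-\lambda^{-1}g)\,\bigl(G^TL^{(2)}_y(\lambda)G\bigr)\,(1-\lambda^{-1}g)^{-1}$, with $G=\mathrm{diag}(k,r)$ and $g=c\begin{pmatrix}0&k^TF\\0&0\end{pmatrix}$, restricted by the Kowalevski constraints $r=1$, $m=-E^T\ell E$ to a function on $T^*SO(p)$. Let $h=\mathrm{diag}(0,F^TF)$. Spectral parameters are always taken nonzero with $1+c^2\lambda^{-2}h$ invertible; call these regular. **Kernels.** Let $Z_\alpha$ be the standard basis of $so(p)\oplus so(q)$ (the matrices $e_{ij}-e_{ji}$, $i<j$, in each block) and $S_\beta$ the standard basis $\begin{pmatrix}0&e_{ij}\\e_{ij}^T&0\end{pmatrix}$ of the symmetric block-off-diagonal matrices. Put $P_{\mathfrak f}=\sum Z_\alpha\otimes Z_\alpha$, $P_{\mathfrak p}=\sum S_\beta\otimes S_\beta$, $$r_{12}(\lambda,\mu)=-\tfrac{\lambda^2}{\lambda^2-\mu^2}P_{\mathfrak f}+\tfrac{\lambda\mu}{\lambda^2-\mu^2}P_{\mathfrak p},\qquad \widetilde r_{12}(\lambda,\mu)=-r_{12}(\lambda^{-1},\mu^{-1}),\qquad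 \widetilde r^{\,Kow}_{12}=\widetilde r_{12}-\sum_\alpha Z_\alpha\otimes Z_\alpha',$$ where $Z'_\alpha$ is the element $e_{ij}-e_{ji}$ of $so(q)$ if $Z_\alpha$ is the element $e_{ij}-e_{ji}$ of $so(p)$ with $i<j\le q$, $Z'_\alpha=0$ for the other basis elements of $so(p)$, and $Z'_\alpha=Z_\alpha$ for those of $so(q)$. Let $$\widehat r^{\,Kow}_{12}(\lambda,\mu)=\bigl[1\otimes(1+c^2\mu^{-2}h)^{-1}\bigr]\,\widetilde r^{\,Kow}_{12}(\lambda,\mu)\,\bigl[(1+c^2\lambda^{-2}h)\otimes1\bigr],\qquad \widehat r^{\,Kow}_{21}(\lambda,\mu)=\Pi\,\widehat r^{\,Kow}_{12}(\mu,\lambda)\,\Pi,$$ with $\Pi$ the permutation operator. These kernels are numerical: they do not depend on the point of the phase space. **Proposition.** (1) For every regular $\lambda$ the matrix $1-\lambda^{-1}y$ is invertible and, with $\gamma=k(1-c\,\ell^T)$ and $d=k\ell k^T$, $$\hat L_y(\lambda)=\Bigl[1+\tfrac{c^2}{\lambda^2}h\Bigr]^{-1}\left[\lambda\begin{pmatrix}0&E\\E^T&0\end{pmatrix}-\begin{pmatrix}\ell&0\\0&-E^T\ell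 E\end{pmatrix}+\lambda^{-1}\begin{pmatrix}0&\gamma^TF\\F^T\gamma&0\end{pmatrix}+\tfrac{c^2}{\lambda^2}\begin{pmatrix}0&0\\0&F^TdF\end{pmatrix}\right].$$ For all regular $\lambda,\mu$ with $\lambda^2\ne\mu^2$, with $\hat L_1=\hat L_y\otimes1$ and $\hat L_2=1\otimes\hat L_y$, it satisfies the linear $r$-matrix relation with the kernel $-\widehat r^{\,Kow}_{12}$: $$\{\hat L_1(\lambda),\hat L_2(\mu)\}=-\bigl[\widehat r^{\,Kow}_{12}(\lambda,\mu),\hat L_1(\lambda)\bigr]+\bigl[\widehat r^{\,Kow}_{21}(\lambda,\mu),\hat L_2(\mu)\bigr].$$ (2) (Tops on $so(4)$.) Let $p=3$, $q\in\{1,2,3\}$, and let $F$ have entry $1$ in the upper left corner and $0$ elsewhere. Put $J_i=-\tfrac12\sum_{j,k}\varepsilon_{ijk}\ell_{jk}$ and $y_i=\gamma_{1i}$ (these $y_i$ are functions on the phase space, not the matrix $y$ above). Then $$\{J_i,J_j\}=\varepsilon_{ijk}J_k,\qquad\{J_i,y_j\}=\varepsilon_{ijk}y_k,\qquad\{y_i,y_j\}=-c^2\varepsilon_{ijk}J_k,\qquad(*)$$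 and $\hat L_y(\lambda)$ depends on $(k,\ell)$ only through $(J,y)$: $$\hat L_y(\lambda)=\Bigl[1+\tfrac{c^2}{\lambda^2}h\Bigr]^{-1}\left[\lambda\begin{pmatrix}0&E\\E^T&0\end{pmatrix}-\begin{pmatrix}\ell&0\\0&-E^T\ell E\end{pmatrix}+\lambda^{-1}\begin{pmatrix}0&Y\\Y^T&0\end{pmatrix}\right],\qquad \ell_{jk}=-\sum_i\varepsilon_{ijk}J_i,$$ where $Y$ is the $3\times q$ matrix with first column $y$ and zeros elsewhere. Moreover, let $\kappa\in\mathbb C$, $\kappa^2=-c^2$, and consider on $so(4)^*$, whose points are the skew-symmetric real $4\times4$ matrices $M$ and whose Lie–Poisson bracket is given by the above formula for $\{\ell_{ij},\ell_{mn}\}$, the functions $J_i=-\frac12\sum_{j,k\le3}\varepsilon_{ijk}M_{jk}$ and $y_i=\kappa M_{i4}$. They satisfy $(*)$, and the last matrix, formed with them, satisfies on all of $so(4)^*$ the linear $r$-matrix relation with the kernel $-\widehat r^{\,Kow}_{12}$ (for all regular $\lambda,\mu$ with $\lambda^2\ne\mu^2$). Finally, denote this matrix by $\mathcal L(\lambda;J,y)$;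 for all $J,y\in\mathbb C^3$, $$\lim_{\lambda\to\infty}\Bigl(\tfrac12\operatorname{tr}\mathcal L(\lambda;J,y)^2-q\lambda^2\Bigr)=-2H-c^2,$$ where $H=\frac12(J_1^2+J_2^2+J_3^2)-y_1$ for $q=1$ and $H=J_1^2+J_2^2+J_3^2-y_1$ for $q=3$ (Lagrange top), and $H=\frac12(J_1^2+J_2^2+2J_3^2)-y_1$ for $q=2$ (Kowalevski top). -/

import Mathlib

open Matrix
open scoped Kronecker Topology

namespace KowalevskiTop

noncomputable section

/-! ### The phase space `T*SO(p)` and Lie-Poisson brackets -/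

/-- Skew-symmetric real matrices: `so(p)`, identified with its dual. -/
abbrev SkewMat (p : ℕ) : Type := {X : Matrix (Fin p) (Fin p) ℝ // Xᵀ = -X}

/-- The group `SO(p)`. -/
abbrev SOGroup (p : ℕ) : Type := Matrix.specialOrthogonalGroup (Fin p) ℝ

/-- `T*SO(p)` in the left trivialization: pairs `(k, ℓ)` with `k ∈ SO(p)`, `ℓ ∈ so(p)`. -/
abbrev CotangentSO (p : ℕ) : Type := SOGroup p × SkewMat p

/-- The elementary skew-symmetric matrix `e_{ij} - e_{ji}`. -/
def elemSkew (R : Type*) [Ring R] {n : ℕ} (a : Fin n × Fin n) : Matrix (Fin n) (Fin n) R :=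
  Matrix.single a.1 a.2 1 - Matrix.single a.2 a.1 1

/-- The index pairs `(i, j)` with `i < j`; the `elemSkew` of these form the standard basis of
`so(n)`. -/
def pairs (n : ℕ) : Finset (Fin n × Fin n) :=
  Finset.univ.filter fun a => a.1 < a.2

theorem elemSkew_transpose (R : Type*) [Ring R] {n : ℕ} (a : Fin n × Fin n) :
    (elemSkew R a)ᵀ = -elemSkew R a := by
  simp [elemSkew]

theorem exp_skew_mem {p : ℕ} (X : Matrix (Fin p) (Fin p) ℝ) (hX : Xᵀ = -X) :
    NormedSpace.exp X ∈ Matrix.specialOrthogonalGroup (Fin p) ℝ := by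
  have orth : ∀ Y : Matrix (Fin p) (Fin p) ℝ, Yᵀ = -Y →
      NormedSpace.exp Y ∈ Matrix.orthogonalGroup (Fin p) ℝ := by
    intro Y hY
    rw [Matrix.mem_orthogonalGroup_iff, ← Matrix.exp_transpose, hY,
      ← Matrix.exp_add_of_commute _ _ (Commute.neg_right (Commute.refl Y)), add_neg_cancel,
      NormedSpace.exp_zero]
  rw [Matrix.mem_specialOrthogonalGroup_iff]
  refine ⟨orth X hX, ?_⟩
  have hY : ((1 / 2 : ℝ) • X)ᵀ = -((1 / 2 : ℝ) • X) := by simp [hX]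
  have h1 := orth _ hY
  rw [Matrix.mem_orthogonalGroup_iff] at h1
  have h2 := congrArg Matrix.det h1
  rw [Matrix.det_mul, Matrix.det_transpose, Matrix.det_one] at h2
  have h3 : X = (1 / 2 : ℝ) • X + (1 / 2 : ℝ) • X := by
    rw [← add_smul]; norm_num
  rw [h3, Matrix.exp_add_of_commute _ _ (Commute.refl _), Matrix.det_mul, h2]

/-- The one-parameter subgroup `t ↦ exp(t (e_{ij} - e_{ji}))` of rotations in the `(i,j)` plane. -/
def rotation {p : ℕ} (a : Fin p × Fin p) (t : ℝ) : SOGroup p :=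
  ⟨NormedSpace.exp (t • elemSkew ℝ a), exp_skew_mem _ (by
    rw [Matrix.transpose_smul, elemSkew_transpose, smul_neg])⟩

/-- The translate `ℓ + t (e_{ij} - e_{ji})` of a skew-symmetric matrix. -/
def shiftSkew {p : ℕ} (a : Fin p × Fin p) (t : ℝ) (l : SkewMat p) : SkewMat p :=
  ⟨l.1 + t • elemSkew ℝ a, by
    rw [Matrix.transpose_add, Matrix.transpose_smul, elemSkew_transpose, l.2, smul_neg, neg_add]⟩

/-- `{ℓ_{ij}, ℓ_{mn}} = δ_{in} ℓ_{jm} + δ_{jm} ℓ_{in} - δ_{im} ℓ_{jn} - δ_{jn} ℓ_{im}`, for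
`a = (i, j)` and `b = (m, n)`. -/
def lieBracketCoord {p : ℕ} (l : Matrix (Fin p) (Fin p) ℝ) (a b : Fin p × Fin p) : ℝ :=
  (if a.1 = b.2 then l a.2 b.1 else 0) + (if a.2 = b.1 then l a.1 b.2 else 0)
    - (if a.1 = b.1 then l a.2 b.2 else 0) - (if a.2 = b.2 then l a.1 b.1 else 0)

/-- The Lie-Poisson bracket on `so(n)*` in the independent coordinates `ℓ_{ij}`, `i < j`. -/
def skewBracket {n : ℕ} (f g : SkewMat n → ℂ) (l : SkewMat n) : ℂ :=
  ∑ a ∈ pairs n, ∑ b ∈ pairs n,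
    deriv (fun t : ℝ => f (shiftSkew a t l)) 0 * deriv (fun t : ℝ => g (shiftSkew b t l)) 0
      * (lieBracketCoord l.1 a b : ℂ)

/-- The derivative `∂f/∂ℓ_{ij}` on `T*SO(p)`. -/
def momentumDeriv {p : ℕ} (a : Fin p × Fin p) (f : CotangentSO p → ℂ) (x : CotangentSO p) : ℂ :=
  deriv (fun t : ℝ => f (x.1, shiftSkew a t x.2)) 0

/-- The derivative of `f` along the left-invariant vector field `k ↦ k (e_{ij} - e_{ji})`. On the
entries of `k` its values are `δ_{jm} k_{ni} - δ_{im} k_{nj}`, that is, `{ℓ_{ij}, k_{nm}}`. -/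
def rotationDeriv {p : ℕ} (a : Fin p × Fin p) (f : CotangentSO p → ℂ) (x : CotangentSO p) : ℂ :=
  deriv (fun t : ℝ => f (x.1 * rotation a t, x.2)) 0

/-- The canonical Poisson bracket of `T*SO(p)`: the bracket with
`{ℓ_{ij}, ℓ_{mn}} = δ_{in} ℓ_{jm} + δ_{jm} ℓ_{in} - δ_{im} ℓ_{jn} - δ_{jn} ℓ_{im}`,
`{ℓ_{ij}, k_{nm}} = δ_{jm} k_{ni} - δ_{im} k_{nj}` and `{k_{ij}, k_{mn}} = 0`. -/
def canonicalBracket {p : ℕ} (f g : CotangentSO p → ℂ) (x : CotangentSO p) : ℂ :=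
  (∑ a ∈ pairs p, ∑ b ∈ pairs p,
      momentumDeriv a f x * momentumDeriv b g x * (lieBracketCoord x.2.1 a b : ℂ))
    + ∑ a ∈ pairs p,
      (momentumDeriv a f x * rotationDeriv a g x - rotationDeriv a f x * momentumDeriv a g x)

/-! ### The linear r-matrix relation -/

/-- The permutation operator `Π` on `V ⊗ V`. -/
def swapMatrix (n : Type*) [DecidableEq n] : Matrix (n × n) (n × n) ℂ :=
  Matrix.of fun a b => if a = b.swap then 1 else 0

/-- `r₂₁(λ, μ) = Π r₁₂(μ, λ) Π`. -/
def r21 {n : Type*} [Fintype n] [DecidableEq n] (r : ℂ → ℂ → Matrix (n × n) (n × n) ℂ)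
    (lam mu : ℂ) : Matrix (n × n) (n × n) ℂ :=
  swapMatrix n * r mu lam * swapMatrix n

/-- The matrix `{L₁(λ), L₂(μ)}` of the brackets of the entries of two matrix-valued functions:
its entry in row `(a, b)`, column `(c, d)` is `{A_{ac}, B_{bd}}`. -/
def bracketMatrix {X n : Type*} (pb : (X → ℂ) → (X → ℂ) → X → ℂ) (A B : X → Matrix n n ℂ) (x : X) :
    Matrix (n × n) (n × n) ℂ :=
  Matrix.of fun a b => pb (fun y => A y a.1 b.1) (fun y => B y a.2 b.2) x

/-- The linear r-matrix relation
`{L₁(λ), L₂(μ)} = [r₁₂(λ, μ), L₁(λ)] - [r₂₁(λ, μ), L₂(μ)]`, where `L₁ = L ⊗ 1`, `L₂ = 1 ⊗ L`,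
at all points of the phase space and all spectral parameters in `S` with `λ² ≠ μ²`. The kernel `r`
does not depend on the point of the phase space. -/
def RMatrixRelation {X n : Type*} [Fintype n] [DecidableEq n]
    (pb : (X → ℂ) → (X → ℂ) → X → ℂ) (L : ℂ → X → Matrix n n ℂ)
    (r : ℂ → ℂ → Matrix (n × n) (n × n) ℂ) (S : Set ℂ) : Prop :=
  ∀ lam ∈ S, ∀ mu ∈ S, lam ^ 2 ≠ mu ^ 2 → ∀ x : X,
    bracketMatrix pb (L lam) (L mu) x =
      (r lam mu * (L lam x ⊗ₖ (1 : Matrix n n ℂ)) - (L lam x ⊗ₖ (1 : Matrix n n ℂ)) * r lam mu)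
      - (r21 r lam mu * ((1 : Matrix n n ℂ) ⊗ₖ L mu x)
          - ((1 : Matrix n n ℂ) ⊗ₖ L mu x) * r21 r lam mu)

/-! ### The Lax matrices -/

/-- The complexification of a real matrix. -/
abbrev cplx {m n : Type*} (A : Matrix m n ℝ) : Matrix m n ℂ := A.map Complex.ofReal

/-- The truncated identity matrix `E`, `E_{ij} = δ_{ij}`. -/
def truncId (p q : ℕ) : Matrix (Fin p) (Fin q) ℂ :=
  Matrix.of fun i j => if i.val = j.val then 1 else 0

section Lax

variable {p q : ℕ}

/-- The Lax matrix of the interacting tops on `T*SO(p) × T*SO(q)`,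
`λ (0, k A rᵀ; r Aᵀ kᵀ, 0) - diag(k ℓ kᵀ, r m rᵀ) + λ⁻¹ (0, F; Fᵀ, 0)`. -/
def laxIn (A F : Matrix (Fin p) (Fin q) ℂ) (k l : Matrix (Fin p) (Fin p) ℂ)
    (r m : Matrix (Fin q) (Fin q) ℂ) (lam : ℂ) : Matrix (Fin p ⊕ Fin q) (Fin p ⊕ Fin q) ℂ :=
  lam • Matrix.fromBlocks 0 (k * A * rᵀ) (r * Aᵀ * kᵀ) 0
    - Matrix.fromBlocks (k * l * kᵀ) 0 0 (r * m * rᵀ)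
    + lam⁻¹ • Matrix.fromBlocks 0 F Fᵀ 0

/-- `y = c (0, F; -Fᵀ, 0)`. -/
def yMat (c : ℂ) (F : Matrix (Fin p) (Fin q) ℂ) : Matrix (Fin p ⊕ Fin q) (Fin p ⊕ Fin q) ℂ :=
  c • Matrix.fromBlocks 0 F (-Fᵀ) 0

/-- The deformed Lax matrix
`L_y^{(2)} = (1 - λ⁻¹ y)⁻¹ [L(λ) - c diag(0, r Aᵀ kᵀ F - Fᵀ k A rᵀ)]`. -/
def laxY2 (c : ℂ) (A F : Matrix (Fin p) (Fin q) ℂ) (k l : Matrix (Fin p) (Fin p) ℂ)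
    (r m : Matrix (Fin q) (Fin q) ℂ) (lam : ℂ) : Matrix (Fin p ⊕ Fin q) (Fin p ⊕ Fin q) ℂ :=
  (1 - lam⁻¹ • yMat c F)⁻¹ *
    (laxIn A F k l r m lam
      - c • Matrix.fromBlocks 0 0 0 (r * Aᵀ * kᵀ * F - Fᵀ * k * A * rᵀ))

/-- The gauge transform `(1 - λ⁻¹ g) (Gᵀ L_y^{(2)} G) (1 - λ⁻¹ g)⁻¹` of `L_y^{(2)}`, where
`G = diag(k, r)` and `g = c (0, kᵀ F; 0, 0)`. -/
def gaugeTransform (c : ℂ) (A F : Matrix (Fin p) (Fin q) ℂ) (k l : Matrix (Fin p) (Fin p) ℂ)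
    (r m : Matrix (Fin q) (Fin q) ℂ) (lam : ℂ) : Matrix (Fin p ⊕ Fin q) (Fin p ⊕ Fin q) ℂ :=
  let G : Matrix (Fin p ⊕ Fin q) (Fin p ⊕ Fin q) ℂ := Matrix.fromBlocks k 0 0 r
  let g : Matrix (Fin p ⊕ Fin q) (Fin p ⊕ Fin q) ℂ := c • Matrix.fromBlocks 0 (kᵀ * F) 0 0
  (1 - lam⁻¹ • g) * (Gᵀ * laxY2 c A F k l r m lam * G) * (1 - lam⁻¹ • g)⁻¹

/-- The gauge transform for `A = E`, restricted by the Kowalevski constraints `r = 1` and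
`m = -Eᵀ ℓ E` to a function on `T*SO(p)`. -/
def reducedGaugeTransform (c : ℂ) (F : Matrix (Fin p) (Fin q) ℝ) (lam : ℂ) (x : CotangentSO p) :
    Matrix (Fin p ⊕ Fin q) (Fin p ⊕ Fin q) ℂ :=
  gaugeTransform c (truncId p q) (cplx F) (cplx x.1.1) (cplx x.2.1) 1
    (-((truncId p q)ᵀ * cplx x.2.1 * truncId p q)) lam

/-- `h = diag(0, Fᵀ F)`. -/
def hMat (F : Matrix (Fin p) (Fin q) ℝ) : Matrix (Fin p ⊕ Fin q) (Fin p ⊕ Fin q) ℂ :=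
  Matrix.fromBlocks 0 0 0 ((cplx F)ᵀ * cplx F)

/-- `γ = k (1 - c ℓᵀ)`, so that `γᵀ = (1 - c ℓ) kᵀ`. -/
def gammaMat (c : ℂ) (x : CotangentSO p) : Matrix (Fin p) (Fin p) ℂ :=
  cplx x.1.1 * (1 - c • (cplx x.2.1)ᵀ)

/-- `d = k ℓ kᵀ`. -/
def dMat (x : CotangentSO p) : Matrix (Fin p) (Fin p) ℂ :=
  cplx x.1.1 * cplx x.2.1 * (cplx x.1.1)ᵀ

/-- The Lax matrix `L̂_y(λ)`: `(1 + c² λ⁻² h)⁻¹` times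
`λ (0, E; Eᵀ, 0) - diag(ℓ, -Eᵀ ℓ E) + λ⁻¹ (0, γᵀ F; Fᵀ γ, 0) + c² λ⁻² diag(0, Fᵀ d F)`. -/
def laxHat (c : ℂ) (F : Matrix (Fin p) (Fin q) ℝ) (lam : ℂ) (x : CotangentSO p) :
    Matrix (Fin p ⊕ Fin q) (Fin p ⊕ Fin q) ℂ :=
  (1 + (c ^ 2 / lam ^ 2) • hMat F)⁻¹ *
    (lam • Matrix.fromBlocks 0 (truncId p q) (truncId p q)ᵀ 0
      - Matrix.fromBlocks (cplx x.2.1) 0 0 (-((truncId p q)ᵀ * cplx x.2.1 * truncId p q))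
      + lam⁻¹ • Matrix.fromBlocks 0 ((gammaMat c x)ᵀ * cplx F) ((cplx F)ᵀ * gammaMat c x) 0
      + (c ^ 2 / lam ^ 2) • Matrix.fromBlocks 0 0 0 ((cplx F)ᵀ * dMat x * cplx F))

/-- The spectral parameters at which `L̂_y(λ)` is defined. -/
def regularPoints (c : ℂ) (F : Matrix (Fin p) (Fin q) ℝ) : Set ℂ :=
  {lam | lam ≠ 0 ∧ IsUnit (1 + (c ^ 2 / lam ^ 2) • hMat F).det}

end Lax

/-! ### The numerical kernels -/

section Kernels

variable (p q : ℕ)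

/-- The basis elements `Z_α` in the summand `so(p)` of `so(p) ⊕ so(q)`. -/
def zUpper (a : Fin p × Fin p) : Matrix (Fin p ⊕ Fin q) (Fin p ⊕ Fin q) ℂ :=
  Matrix.fromBlocks (elemSkew ℂ a) 0 0 0

/-- The basis elements `Z_α` in the summand `so(q)` of `so(p) ⊕ so(q)`. -/
def zLower (b : Fin q × Fin q) : Matrix (Fin p ⊕ Fin q) (Fin p ⊕ Fin q) ℂ :=
  Matrix.fromBlocks 0 0 0 (elemSkew ℂ b)

/-- The symmetric basis elements `S_β`. -/
def sMat (b : Fin p × Fin q) : Matrix (Fin p ⊕ Fin q) (Fin p ⊕ Fin q) ℂ :=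
  Matrix.fromBlocks 0 (Matrix.single b.1 b.2 1) (Matrix.single b.2 b.1 1) 0

/-- `P_f = ∑ Z_α ⊗ Z_α`. -/
def casimirF : Matrix ((Fin p ⊕ Fin q) × (Fin p ⊕ Fin q)) ((Fin p ⊕ Fin q) × (Fin p ⊕ Fin q)) ℂ :=
  ∑ a ∈ pairs p, zUpper p q a ⊗ₖ zUpper p q a + ∑ b ∈ pairs q, zLower p q b ⊗ₖ zLower p q b

/-- `P_p = ∑ S_β ⊗ S_β`. -/
def casimirP : Matrix ((Fin p ⊕ Fin q) × (Fin p ⊕ Fin q)) ((Fin p ⊕ Fin q) × (Fin p ⊕ Fin q)) ℂ :=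
  ∑ b : Fin p × Fin q, sMat p q b ⊗ₖ sMat p q b

/-- The kernel `r₁₂(λ, μ) = -λ²/(λ² - μ²) P_f + λμ/(λ² - μ²) P_p`. -/
def rRest (lam mu : ℂ) :
    Matrix ((Fin p ⊕ Fin q) × (Fin p ⊕ Fin q)) ((Fin p ⊕ Fin q) × (Fin p ⊕ Fin q)) ℂ :=
  (-(lam ^ 2 / (lam ^ 2 - mu ^ 2))) • casimirF p q + (lam * mu / (lam ^ 2 - mu ^ 2)) • casimirP p q

/-- The body-frame kernel `r̃₁₂(λ, μ) = -r₁₂(λ⁻¹, μ⁻¹)`. -/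
def rBody (lam mu : ℂ) :
    Matrix ((Fin p ⊕ Fin q) × (Fin p ⊕ Fin q)) ((Fin p ⊕ Fin q) × (Fin p ⊕ Fin q)) ℂ :=
  -rRest p q lam⁻¹ mu⁻¹

/-- `∑ Z_α ⊗ Z_α'`, where `Z_α'` is the copy of `Z_α` in `so(q)` if `Z_α` is an element
`e_{ij} - e_{ji}` of `so(p)` with `i < j ≤ q`; `Z_α' = 0` for the other elements of `so(p)`; and
`Z_α' = Z_α` for the elements of `so(q)`. (For skew `ℓ ∈ so(p)`, the matrix `Eᵀ ℓ E` is the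
upper left `q × q` block.) -/
def kowCorrection :
    Matrix ((Fin p ⊕ Fin q) × (Fin p ⊕ Fin q)) ((Fin p ⊕ Fin q) × (Fin p ⊕ Fin q)) ℂ :=
  ∑ a ∈ pairs p, zUpper p q a ⊗ₖ
      (Matrix.fromBlocks 0 0 0 ((truncId p q)ᵀ * elemSkew ℂ a * truncId p q) :
        Matrix (Fin p ⊕ Fin q) (Fin p ⊕ Fin q) ℂ)
    + ∑ b ∈ pairs q, zLower p q b ⊗ₖ zLower p q b

/-- The reduced kernel `r̃₁₂^{Kow}`. -/
def rKow (lam mu : ℂ) :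
    Matrix ((Fin p ⊕ Fin q) × (Fin p ⊕ Fin q)) ((Fin p ⊕ Fin q) × (Fin p ⊕ Fin q)) ℂ :=
  rBody p q lam mu - kowCorrection p q

end Kernels

/-- The kernel `[1 ⊗ (1 + c² μ⁻² h)⁻¹] r̃₁₂^{Kow}(λ, μ) [(1 + c² λ⁻² h) ⊗ 1]`. -/
def rHat {p q : ℕ} (c : ℂ) (F : Matrix (Fin p) (Fin q) ℝ) (lam mu : ℂ) :
    Matrix ((Fin p ⊕ Fin q) × (Fin p ⊕ Fin q)) ((Fin p ⊕ Fin q) × (Fin p ⊕ Fin q)) ℂ :=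
  ((1 : Matrix (Fin p ⊕ Fin q) (Fin p ⊕ Fin q) ℂ) ⊗ₖ (1 + (c ^ 2 / mu ^ 2) • hMat F)⁻¹)
    * rKow p q lam mu
    * ((1 + (c ^ 2 / lam ^ 2) • hMat F) ⊗ₖ (1 : Matrix (Fin p ⊕ Fin q) (Fin p ⊕ Fin q) ℂ))

/-! ### The tops on `so(4)` -/

/-- The Levi-Civita symbol `ε_{ijk}`. -/
def levi (i j k : Fin 3) : ℂ :=
  ((j.val : ℂ) - i.val) * ((k.val : ℂ) - i.val) * ((k.val : ℂ) - j.val) / 2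

/-- The `3 × q` matrix with entry `1` in the upper left corner and `0` elsewhere. -/
def cornerMat (q : ℕ) : Matrix (Fin 3) (Fin q) ℝ :=
  Matrix.of fun i j => if i.val = 0 ∧ j.val = 0 then 1 else 0

/-- The Lax matrix of the tops in the variables `J, y`:
`(1 + c² λ⁻² h)⁻¹ [λ (0, E; Eᵀ, 0) - diag(ℓ, -Eᵀ ℓ E) + λ⁻¹ (0, Y; Yᵀ, 0)]`, where
`ℓ_{jk} = -∑ ε_{ijk} J_i`, the first column of the `3 × q` matrix `Y` is `y` and the others
vanish. -/
def topLax (q : ℕ) (c : ℂ) (lam : ℂ) (J y : Fin 3 → ℂ) :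
    Matrix (Fin 3 ⊕ Fin q) (Fin 3 ⊕ Fin q) ℂ :=
  let l : Matrix (Fin 3) (Fin 3) ℂ := Matrix.of fun j k => -∑ i, levi i j k * J i
  let Y : Matrix (Fin 3) (Fin q) ℂ := Matrix.of fun i j => if j.val = 0 then y i else 0
  (1 + (c ^ 2 / lam ^ 2) • hMat (cornerMat q))⁻¹ *
    (lam • Matrix.fromBlocks 0 (truncId 3 q) (truncId 3 q)ᵀ 0
      - Matrix.fromBlocks l 0 0 (-((truncId 3 q)ᵀ * l * truncId 3 q))
      + lam⁻¹ • Matrix.fromBlocks 0 Y Yᵀ 0)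

/-- `J_i = -½ ∑ ε_{ijk} ℓ_{jk}` on `T*SO(3)`. -/
def bodyJ (x : CotangentSO 3) (i : Fin 3) : ℂ :=
  -(1 / 2) * ∑ j, ∑ k, levi i j k * (x.2.1 j k : ℂ)

/-- `y_i = γ_{1i}`, the first row of `γ`, on `T*SO(3)`. -/
def bodyY (c : ℂ) (x : CotangentSO 3) (i : Fin 3) : ℂ := gammaMat c x 0 i

/-- `J_i = -½ ∑ ε_{ijk} M_{jk}` on `so(4)*`, the sum being over the indices of the subalgebra
`so(3)`. -/
def so4J (M : SkewMat 4) (i : Fin 3) : ℂ :=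
  -(1 / 2) * ∑ j : Fin 3, ∑ k : Fin 3, levi i j k * (M.1 j.castSucc k.castSucc : ℂ)

/-- `y_i = κ M_{i4}` on `so(4)*`. -/
def so4Y (kappa : ℂ) (M : SkewMat 4) (i : Fin 3) : ℂ :=
  kappa * (M.1 i.castSucc (Fin.last 3) : ℂ)

/-- The Hamiltonian `½ (J₁² + J₂² + J₃²) - y₁` (`q = 1`) or `J₁² + J₂² + J₃² - y₁` (`q = 3`) of the
Lagrange top, and `½ (J₁² + J₂² + 2 J₃²) - y₁` (`q = 2`) of the Kowalevski top. -/
def topHamiltonian (q : ℕ) (J y : Fin 3 → ℂ) : ℂ :=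
  if q = 1 then (J 0 ^ 2 + J 1 ^ 2 + J 2 ^ 2) / 2 - y 0
  else if q = 2 then (J 0 ^ 2 + J 1 ^ 2 + 2 * J 2 ^ 2) / 2 - y 0
  else J 0 ^ 2 + J 1 ^ 2 + J 2 ^ 2 - y 0

/-- The relations `{J_i, J_j} = ε_{ijk} J_k`, `{J_i, y_j} = ε_{ijk} y_k`,
`{y_i, y_j} = s ε_{ijk} J_k` (summation over `k`) for functions on a phase space. -/
def SO4Relations {X : Type*} (pb : (X → ℂ) → (X → ℂ) → X → ℂ) (s : ℂ) (J y : X → Fin 3 → ℂ) :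
    Prop :=
  ∀ (i j : Fin 3) (x : X),
    pb (fun z => J z i) (fun z => J z j) x = ∑ k, levi i j k * J x k ∧
    pb (fun z => J z i) (fun z => y z j) x = ∑ k, levi i j k * y x k ∧
    pb (fun z => y z i) (fun z => y z j) x = s * ∑ k, levi i j k * J x k

end

end KowalevskiTop

open KowalevskiTop

namespace KowalevskiTop

/-! ### Biderivations -/

/-! Write `u = kᵀ F`, `v = (1 - c ℓ) u = γᵀ F`, `w = uᵀ ℓ u = Fᵀ d F` and `H(λ) = 1 + c² λ⁻² h`. The
claimed form of the Lax matrix is `H⁻¹ N`, where `N` is affine in the entries of `ℓ`, `v`, `w`.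

The gauge identity is block elimination. In the body frame `1 - λ⁻¹ y` factors as `B H A`, with `B`
lower unipotent, `A = 1 - λ⁻¹ g` upper unipotent and `H` carrying the Schur complement. The
bracketed factor of `L_y^{(2)}` becomes `B N A` with the same `A` and `B`. Hence the quotient is
`A⁻¹ H⁻¹ N A`, and conjugation by `A` leaves `H⁻¹ N` (`reducedGaugeTransform_eq`).

The r-matrix relation rests on two facts. Since `uᵀ u = Fᵀ F` is constant, the brackets of `ℓ`, `v`,
`w` are linear in `ℓ`, `v`, `w` with constant coefficients (`IsTopAlgebra`, obtained in
`isTopAlgebra_of_semidirect`); the terms of first order in `c`, which would be quadratic in `u`,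
cancel. Moreover the factors `H` in the kernel are placed so that `H₁⁻¹ ⊗ H₂⁻¹` can be pulled out of
the whole relation (`kernel_commutator_eq`). What remains is an identity without inverses, affine in
`ℓ`, `v`, `w`, which is compared block by block in `IsTopAlgebra.bracket_laxNumerator`.

Only `IsTopAlgebra` enters that argument. For the corner matrix `F` the skew matrix `w` vanishes,
and on `so(4)*` the functions `M_{ij}` and `κ M_{i4}` satisfy the same bracket relations with `w =
0`, so the same relation holds there. The Hamiltonians come from an explicit trace, in which `H⁻¹`
rescales a single row. -/

/-- The bracket `pb` is an antisymmetric biderivation on the algebra `S` of functions. -/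
structure IsBiderivationOn {X : Type*} (pb : (X → ℂ) → (X → ℂ) → X → ℂ)
    (S : Subalgebra ℂ (X → ℂ)) : Prop where
  symm : ∀ f ∈ S, ∀ g ∈ S, ∀ x, pb f g x = -pb g f x
  const_left : ∀ (a : ℂ), ∀ g ∈ S, ∀ x, pb (fun _ => a) g x = 0
  add_left : ∀ f ∈ S, ∀ f' ∈ S, ∀ g ∈ S, ∀ x, pb (fun y => f y + f' y) g x = pb f g x + pb f' g x
  mul_left : ∀ f ∈ S, ∀ f' ∈ S, ∀ g ∈ S, ∀ x,
    pb (fun y => f y * f' y) g x = f x * pb f' g x + f' x * pb f g x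

section Subalgebra

variable {X : Type*} {S : Subalgebra ℂ (X → ℂ)} {f g : X → ℂ}

theorem const_mem_fun (S : Subalgebra ℂ (X → ℂ)) (a : ℂ) : (fun _ : X => a) ∈ S :=
  S.algebraMap_mem a

theorem add_mem_fun (hf : f ∈ S) (hg : g ∈ S) : (fun y => f y + g y) ∈ S := S.add_mem hf hg

theorem sub_mem_fun (hf : f ∈ S) (hg : g ∈ S) : (fun y => f y - g y) ∈ S := sub_mem hf hg

theorem mul_mem_fun (hf : f ∈ S) (hg : g ∈ S) : (fun y => f y * g y) ∈ S := S.mul_mem hf hg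

theorem const_mul_mem_fun (a : ℂ) (hf : f ∈ S) : (fun y => a * f y) ∈ S :=
  S.mul_mem (const_mem_fun S a) hf

theorem neg_mem_fun (hf : f ∈ S) : (fun y => -f y) ∈ S := neg_mem hf

theorem sum_mem_fun {ι : Type*} (s : Finset ι) {f : ι → X → ℂ} (hf : ∀ i, f i ∈ S) :
    (fun y => ∑ i ∈ s, f i y) ∈ S := by
  have := S.sum_mem (t := s) (f := f) (fun i _ => hf i)
  convert this using 1
  ext y
  simp

end Subalgebra

namespace IsBiderivationOn

variable {X : Type*} {pb : (X → ℂ) → (X → ℂ) → X → ℂ} {S : Subalgebra ℂ (X → ℂ)}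
  (h : IsBiderivationOn pb S) {f f' g g' : X → ℂ} (x : X)

include h

theorem const_right (a : ℂ) (hf : f ∈ S) : pb f (fun _ => a) x = 0 := by
  rw [h.symm _ hf _ (const_mem_fun S a), h.const_left a f hf, neg_zero]

theorem add_right (hf : f ∈ S) (hg : g ∈ S) (hg' : g' ∈ S) :
    pb f (fun y => g y + g' y) x = pb f g x + pb f g' x := by
  rw [h.symm _ hf _ (add_mem_fun hg hg'), h.add_left _ hg _ hg' _ hf, h.symm _ hf _ hg,
    h.symm _ hf _ hg']
  ring

theorem mul_right (hf : f ∈ S) (hg : g ∈ S) (hg' : g' ∈ S) :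
    pb f (fun y => g y * g' y) x = g x * pb f g' x + g' x * pb f g x := by
  rw [h.symm _ hf _ (mul_mem_fun hg hg'), h.mul_left _ hg _ hg' _ hf, h.symm _ hf _ hg,
    h.symm _ hf _ hg']
  ring

theorem const_mul_left (a : ℂ) (hf : f ∈ S) (hg : g ∈ S) :
    pb (fun y => a * f y) g x = a * pb f g x := by
  rw [h.mul_left _ (const_mem_fun S a) _ hf _ hg, h.const_left a g hg]
  ring

theorem const_mul_right (a : ℂ) (hf : f ∈ S) (hg : g ∈ S) :
    pb f (fun y => a * g y) x = a * pb f g x := by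
  rw [h.mul_right x hf (const_mem_fun S a) hg, h.const_right x a hf]
  ring

theorem neg_left (hf : f ∈ S) (hg : g ∈ S) : pb (fun y => -f y) g x = -pb f g x := by
  simpa using h.const_mul_left x (-1) hf hg

theorem neg_right (hf : f ∈ S) (hg : g ∈ S) : pb f (fun y => -g y) x = -pb f g x := by
  simpa using h.const_mul_right x (-1) hf hg

theorem sub_left (hf : f ∈ S) (hf' : f' ∈ S) (hg : g ∈ S) :
    pb (fun y => f y - f' y) g x = pb f g x - pb f' g x := by
  have := h.add_left f hf _ (neg_mem_fun hf') g hg x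
  rw [h.neg_left x hf' hg] at this
  simpa [sub_eq_add_neg] using this

theorem sub_right (hf : f ∈ S) (hg : g ∈ S) (hg' : g' ∈ S) :
    pb f (fun y => g y - g' y) x = pb f g x - pb f g' x := by
  have := h.add_right x hf hg (neg_mem_fun hg')
  rw [h.neg_right x hf hg'] at this
  simpa [sub_eq_add_neg] using this

theorem sum_left {ι : Type*} (s : Finset ι) {f : ι → X → ℂ} (hf : ∀ i, f i ∈ S) (hg : g ∈ S) :
    pb (fun y => ∑ i ∈ s, f i y) g x = ∑ i ∈ s, pb (f i) g x := by
  classical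
  induction s using Finset.induction_on with
  | empty => simpa using h.const_left 0 g hg x
  | insert i s hi ih =>
    simp only [Finset.sum_insert hi]
    rw [h.add_left _ (hf i) _ (sum_mem_fun s hf) _ hg, ih]

theorem sum_right {ι : Type*} (s : Finset ι) {g : ι → X → ℂ} (hf : f ∈ S) (hg : ∀ i, g i ∈ S) :
    pb f (fun y => ∑ i ∈ s, g i y) x = ∑ i ∈ s, pb f (g i) x := by
  rw [h.symm _ hf _ (sum_mem_fun s hg), h.sum_left x s hg hf, ← Finset.sum_neg_distrib]
  exact Finset.sum_congr rfl fun i _ => (h.symm _ hf _ (hg i) x).symm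

end IsBiderivationOn

/-! ### Brackets built from directional derivatives -/

section Paths

variable {X ι : Type*} (path : ι → X → ℝ → X)

/-- The algebra of the functions that are differentiable along given paths. -/
def pathAlgebra : Subalgebra ℂ (X → ℂ) where
  carrier := {f | ∀ i x, DifferentiableAt ℝ (fun t => f (path i x t)) 0}
  mul_mem' hf hg i x := (hf i x).mul (hg i x)
  add_mem' hf hg i x := (hf i x).add (hg i x)
  algebraMap_mem' _ _ _ := differentiableAt_const _

/-- The directional derivative along a path. -/
noncomputable def pathDeriv (i : ι) (f : X → ℂ) (x : X) : ℂ := deriv (fun t => f (path i x t)) 0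

theorem isBiderivationOn_pathAlgebra (hpath : ∀ i x, path i x 0 = x) (s : Finset ι)
    (P : ι → ι → X → ℂ) (hP : ∀ i j x, P i j x = -P j i x) :
    IsBiderivationOn
      (fun f g x => ∑ i ∈ s, ∑ j ∈ s, pathDeriv path i f x * pathDeriv path j g x * P i j x)
      (pathAlgebra path) where
  symm f _ g _ x := by
    rw [Finset.sum_comm]
    simp only [← Finset.sum_neg_distrib]
    refine Finset.sum_congr rfl fun i _ => Finset.sum_congr rfl fun j _ => ?_
    rw [hP]
    ring
  const_left a g _ x := by simp [pathDeriv]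
  add_left f hf f' hf' g _ x := by
    have key (i : ι) : pathDeriv path i (fun y => f y + f' y) x
        = pathDeriv path i f x + pathDeriv path i f' x := deriv_fun_add (hf i x) (hf' i x)
    simp only [key, add_mul, Finset.sum_add_distrib]
  mul_left f hf f' hf' g _ x := by
    have key (i : ι) : pathDeriv path i (fun y => f y * f' y) x
        = f x * pathDeriv path i f' x + f' x * pathDeriv path i f x := by
      refine (deriv_fun_mul (hf i x) (hf' i x)).trans ?_
      -- The product rule yields values at the point `path i x 0`, which is `x`.
      simp only [hpath, pathDeriv]
      ring
    simp only [key, Finset.mul_sum, ← Finset.sum_add_distrib]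
    refine Finset.sum_congr rfl fun i _ => Finset.sum_congr rfl fun j _ => ?_
    ring

end Paths

/-! ### Slices of matrices on a tensor square -/

section Slices

variable {n : Type*}

/-- The matrix in the first tensor factor obtained by fixing the indices of the second one. -/
def tensorSlice (b d : n) (M : Matrix (n × n) (n × n) ℂ) : Matrix n n ℂ :=
  Matrix.of fun a c => M (a, b) (c, d)

theorem tensorSlice_kronecker (b d : n) (A B : Matrix n n ℂ) :
    tensorSlice b d (A ⊗ₖ B) = B b d • A := by
  ext a c
  simp [tensorSlice, mul_comm]

theorem tensorSlice_add (b d : n) (M M' : Matrix (n × n) (n × n) ℂ) :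
    tensorSlice b d (M + M') = tensorSlice b d M + tensorSlice b d M' := rfl

theorem tensorSlice_sub (b d : n) (M M' : Matrix (n × n) (n × n) ℂ) :
    tensorSlice b d (M - M') = tensorSlice b d M - tensorSlice b d M' := rfl

theorem tensorSlice_smul (b d : n) (a : ℂ) (M : Matrix (n × n) (n × n) ℂ) :
    tensorSlice b d (a • M) = a • tensorSlice b d M := rfl

theorem tensorSlice_sum {ι : Type*} (s : Finset ι) (b d : n) (M : ι → Matrix (n × n) (n × n) ℂ) :
    tensorSlice b d (∑ i ∈ s, M i) = ∑ i ∈ s, tensorSlice b d (M i) := by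
  ext a c
  simp [tensorSlice, Matrix.sum_apply]

theorem submatrix_swap_kronecker (A B : Matrix n n ℂ) :
    (A ⊗ₖ B).submatrix Prod.swap Prod.swap = B ⊗ₖ A := by
  ext a b
  simp [mul_comm]

variable [Fintype n]

theorem submatrix_swap_mul (M M' : Matrix (n × n) (n × n) ℂ) :
    (M * M').submatrix Prod.swap Prod.swap
      = M.submatrix Prod.swap Prod.swap * M'.submatrix Prod.swap Prod.swap :=
  Matrix.submatrix_mul _ _ _ _ _ Prod.swap_bijective

variable [DecidableEq n]

theorem tensorSlice_kronecker_one_mul (b d : n) (A : Matrix n n ℂ) (M : Matrix (n × n) (n × n) ℂ) :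
    tensorSlice b d ((A ⊗ₖ (1 : Matrix n n ℂ)) * M) = A * tensorSlice b d M := by
  ext a c
  simp [tensorSlice, Matrix.mul_apply, Fintype.sum_prod_type, Matrix.one_apply]

theorem tensorSlice_mul_kronecker_one (b d : n) (A : Matrix n n ℂ) (M : Matrix (n × n) (n × n) ℂ) :
    tensorSlice b d (M * (A ⊗ₖ (1 : Matrix n n ℂ))) = tensorSlice b d M * A := by
  ext a c
  simp [tensorSlice, Matrix.mul_apply, Fintype.sum_prod_type, Matrix.one_apply]

theorem swapMatrix_mul_mul_swapMatrix (M : Matrix (n × n) (n × n) ℂ) :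
    swapMatrix n * M * swapMatrix n = M.submatrix Prod.swap Prod.swap := by
  have hl (M : Matrix (n × n) (n × n) ℂ) : swapMatrix n * M = M.submatrix Prod.swap id := by
    ext a b
    simp only [Matrix.mul_apply, swapMatrix, Matrix.of_apply, ite_mul, one_mul, zero_mul,
      Matrix.submatrix_apply, id]
    rw [Finset.sum_eq_single a.swap]
    · simp
    · intro e _ he
      rw [if_neg]
      rintro rfl
      simp at he
    · simp
  have hr (M : Matrix (n × n) (n × n) ℂ) : M * swapMatrix n = M.submatrix id Prod.swap := by
    ext a b
    simp [Matrix.mul_apply, swapMatrix]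
  rw [hl, hr]
  rfl

theorem mul_single_mul_apply (A B : Matrix n n ℂ) (a i j c : n) :
    (A * Matrix.single i j (1 : ℂ) * B : Matrix n n ℂ) a c = A a i * B j c := by
  rw [Matrix.mul_assoc, Matrix.mul_apply, Finset.sum_eq_single i]
  · simp
  · intro e _ he
    simp [Matrix.single_mul_apply_of_ne _ _ _ _ _ he]
  · simp

/-- The expression `(H ⊗ 1) r (N ⊗ 1) - (N ⊗ 1) r (H ⊗ 1)`, a commutator of `r` and `N` dressed
by `H`. -/
def dressedCommutator (r : Matrix (n × n) (n × n) ℂ) (H N : Matrix n n ℂ) :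
    Matrix (n × n) (n × n) ℂ :=
  (H ⊗ₖ (1 : Matrix n n ℂ)) * r * (N ⊗ₖ (1 : Matrix n n ℂ))
    - (N ⊗ₖ (1 : Matrix n n ℂ)) * r * (H ⊗ₖ (1 : Matrix n n ℂ))

/-- Factors `A ⊗ 1` act on the first tensor factor only, so they pass through a slice with the
second indices fixed. Entries on the tensor square thus reduce to products of ordinary matrices. -/
theorem dressedCommutator_apply (r : Matrix (n × n) (n × n) ℂ) (H N : Matrix n n ℂ) (a b c d : n) :
    dressedCommutator r H N (a, b) (c, d)
      = (H * tensorSlice b d r * N - N * tensorSlice b d r * H) a c := by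
  rw [← tensorSlice_kronecker_one_mul, ← tensorSlice_kronecker_one_mul,
    ← tensorSlice_mul_kronecker_one, ← tensorSlice_mul_kronecker_one]
  rfl

/-- In the first product the factor `H ⊗ 1` of the kernel meets `H⁻¹` and cancels. In the second, `1
⊗ H'⁻¹` commutes with everything in the first factor. Both terms then have `H⁻¹ ⊗ H'⁻¹` on the left.
-/
theorem kernel_commutator_eq (r : Matrix (n × n) (n × n) ℂ) (H H' N : Matrix n n ℂ)
    (hH : IsUnit H.det) :
    ((1 : Matrix n n ℂ) ⊗ₖ H'⁻¹ * r * (H ⊗ₖ (1 : Matrix n n ℂ)))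
          * ((H⁻¹ * N) ⊗ₖ (1 : Matrix n n ℂ))
        - ((H⁻¹ * N) ⊗ₖ (1 : Matrix n n ℂ))
          * ((1 : Matrix n n ℂ) ⊗ₖ H'⁻¹ * r * (H ⊗ₖ (1 : Matrix n n ℂ)))
      = (H⁻¹ ⊗ₖ H'⁻¹) * dressedCommutator r H N := by
  have h1 : (H ⊗ₖ (1 : Matrix n n ℂ)) * ((H⁻¹ * N) ⊗ₖ (1 : Matrix n n ℂ))
      = N ⊗ₖ (1 : Matrix n n ℂ) := by
    rw [← Matrix.mul_kronecker_mul, Matrix.mul_nonsing_inv_cancel_left _ _ hH, Matrix.one_mul]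
  have h2 : (H⁻¹ ⊗ₖ H'⁻¹) * (H ⊗ₖ (1 : Matrix n n ℂ)) = (1 : Matrix n n ℂ) ⊗ₖ H'⁻¹ := by
    rw [← Matrix.mul_kronecker_mul, Matrix.nonsing_inv_mul _ hH, Matrix.mul_one]
  have h3 : ((H⁻¹ * N) ⊗ₖ (1 : Matrix n n ℂ)) * ((1 : Matrix n n ℂ) ⊗ₖ H'⁻¹)
      = (H⁻¹ ⊗ₖ H'⁻¹) * (N ⊗ₖ (1 : Matrix n n ℂ)) := by
    rw [← Matrix.mul_kronecker_mul, ← Matrix.mul_kronecker_mul, Matrix.one_mul, Matrix.mul_one,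
      Matrix.mul_one]
  rw [dressedCommutator, Matrix.mul_sub]
  congr 1
  · rw [Matrix.mul_assoc (_ * r), h1, ← h2]
    simp only [Matrix.mul_assoc]
  · rw [Matrix.mul_assoc _ r, ← Matrix.mul_assoc, h3]
    simp only [Matrix.mul_assoc]

end Slices

/-! ### Reduction of the r-matrix relation to an identity without inverses. -/

theorem IsBiderivationOn.bracketMatrix_mul {X n : Type*} [Fintype n]
    {pb : (X → ℂ) → (X → ℂ) → X → ℂ} {S : Subalgebra ℂ (X → ℂ)} (h : IsBiderivationOn pb S)
    (U V : Matrix n n ℂ) {A B : X → Matrix n n ℂ} (hA : ∀ i j, (fun y => A y i j) ∈ S)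
    (hB : ∀ i j, (fun y => B y i j) ∈ S) (x : X) :
    bracketMatrix pb (fun y => U * A y) (fun y => V * B y) x
      = (U ⊗ₖ V) * bracketMatrix pb A B x := by
  ext ⟨a, b⟩ ⟨c, d⟩
  simp only [bracketMatrix, Matrix.of_apply, Matrix.mul_apply, Fintype.sum_prod_type,
    Matrix.kroneckerMap_apply]
  rw [h.sum_left x _ (fun i => const_mul_mem_fun _ (hA i c))
    (sum_mem_fun _ fun j => const_mul_mem_fun _ (hB j d))]
  refine Finset.sum_congr rfl fun i _ => ?_
  rw [h.sum_right x _ (const_mul_mem_fun _ (hA i c)) (fun j => const_mul_mem_fun _ (hB j d))]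
  refine Finset.sum_congr rfl fun j _ => ?_
  rw [h.const_mul_left x _ (hA i c) (const_mul_mem_fun _ (hB j d)),
    h.const_mul_right x _ (hA i c) (hB j d), mul_assoc]

/-- The r-matrix relation of `H⁻¹ N` with the dressed kernel follows from an inverse-free identity
for `N`. -/
theorem rMatrixRelation_of_dressed {X n : Type*} [Fintype n] [DecidableEq n]
    {pb : (X → ℂ) → (X → ℂ) → X → ℂ} {S : Subalgebra ℂ (X → ℂ)} (hpb : IsBiderivationOn pb S)
    {r : ℂ → ℂ → Matrix (n × n) (n × n) ℂ} {H : ℂ → Matrix n n ℂ} {N : ℂ → X → Matrix n n ℂ}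
    {T : Set ℂ} (hH : ∀ lam ∈ T, IsUnit (H lam).det)
    (hN : ∀ lam i j, (fun y => N lam y i j) ∈ S)
    (hrel : ∀ lam ∈ T, ∀ mu ∈ T, lam ^ 2 ≠ mu ^ 2 → ∀ x a b c d,
      pb (fun y => N lam y a c) (fun y => N mu y b d) x
        = dressedCommutator (r mu lam) (H mu) (N mu x) (b, a) (d, c)
          - dressedCommutator (r lam mu) (H lam) (N lam x) (a, b) (c, d)) :
    RMatrixRelation pb (fun lam x => (H lam)⁻¹ * N lam x)
      (fun lam mu => -((1 : Matrix n n ℂ) ⊗ₖ (H mu)⁻¹ * r lam mu * (H lam ⊗ₖ (1 : Matrix n n ℂ))))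
      T := by
  intro lam hlam mu hmu hne x
  -- The interchanged index pairs `(b, a)`, `(d, c)` in `hrel` are the conjugation by `Π` contained
  -- in `r21`.
  have hB : bracketMatrix pb (N lam) (N mu) x
      = (dressedCommutator (r mu lam) (H mu) (N mu x)).submatrix Prod.swap Prod.swap
        - dressedCommutator (r lam mu) (H lam) (N lam x) := by
    ext ⟨a, b⟩ ⟨c, d⟩
    exact hrel lam hlam mu hmu hne x a b c d
  have h1 := kernel_commutator_eq (r lam mu) (H lam) (H mu) (N lam x) (hH lam hlam)
  have h2 := congrArg (fun M => M.submatrix Prod.swap Prod.swap)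
    (kernel_commutator_eq (r mu lam) (H mu) (H lam) (N mu x) (hH mu hmu))
  simp only [Matrix.submatrix_sub, Pi.sub_apply, submatrix_swap_mul, submatrix_swap_kronecker] at h2
  rw [hpb.bracketMatrix_mul _ _ (hN lam) (hN mu), hB, Matrix.mul_sub, ← h1, ← h2]
  simp only [r21, swapMatrix_mul_mul_swapMatrix, submatrix_swap_mul, submatrix_swap_kronecker,
    Matrix.neg_mul, Matrix.mul_neg]
  abel

/-! ### The kernel in coordinates -/

theorem elemSkew_apply {n : ℕ} (a : Fin n × Fin n) (i j : Fin n) :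
    elemSkew ℂ a i j = (1 : Matrix (Fin n) (Fin n) ℂ) a.1 i * (1 : Matrix (Fin n) (Fin n) ℂ) a.2 j
      - (1 : Matrix (Fin n) (Fin n) ℂ) a.2 i * (1 : Matrix (Fin n) (Fin n) ℂ) a.1 j := by
  simp only [elemSkew, Matrix.sub_apply, Matrix.single_apply, Matrix.one_apply, mul_ite, mul_one,
    mul_zero, ite_and]
  congr 1 <;> split_ifs <;> rfl

theorem elemSkew_swap (R : Type*) [Ring R] {n : ℕ} (i j : Fin n) :
    elemSkew R (j, i) = -elemSkew R (i, j) := by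
  simp [elemSkew]

/-- Contraction of an antisymmetric function with the standard basis of skew matrices. -/
theorem sum_pairs_elemSkew_smul {M : Type*} [AddCommGroup M] [Module ℂ M] {n : ℕ}
    (f : Fin n × Fin n → M) (hf : ∀ i j, f (j, i) = -f (i, j)) (i j : Fin n) :
    ∑ a ∈ pairs n, elemSkew ℂ a i j • f a = f (i, j) := by
  rcases lt_trichotomy i j with h | rfl | h
  · rw [Finset.sum_eq_single (i, j)]
    · simp [elemSkew_apply, Matrix.one_apply, h.ne]
    · rintro ⟨m, k⟩ hmk hne
      simp only [pairs, Finset.mem_filter, Finset.mem_univ, true_and] at hmk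
      simp only [elemSkew_apply, Matrix.one_apply]
      have h1 : ¬(k = j ∧ m = i) := fun h => hne (by rw [h.1, h.2])
      have h2 : ¬(m = j ∧ k = i) := fun h' => by
        rw [h'.1, h'.2] at hmk
        exact lt_asymm h hmk
      simp [← ite_and, h1, h2]
    · simp [pairs, h]
  · have h0 : f (i, i) = 0 := by
      have h1 : f (i, i) + f (i, i) = 0 := by nth_rewrite 1 [hf i i]; simp
      have h2 : (2 : ℂ) • f (i, i) = 0 := by rw [two_smul, h1]
      simpa using h2
    rw [h0]
    refine Finset.sum_eq_zero fun a _ => ?_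
    rw [elemSkew_apply, mul_comm, sub_self, zero_smul]
  · rw [Finset.sum_eq_single (j, i)]
    · simp [elemSkew_apply, Matrix.one_apply, h.ne, hf i j]
    · rintro ⟨m, k⟩ hmk hne
      simp only [pairs, Finset.mem_filter, Finset.mem_univ, true_and] at hmk
      simp only [elemSkew_apply, Matrix.one_apply]
      have h1 : ¬(m = j ∧ k = i) := fun h => hne (by rw [h.1, h.2])
      have h2 : ¬(k = j ∧ m = i) := fun h' => by
        rw [h'.1, h'.2] at hmk
        exact lt_asymm h hmk
      simp [← ite_and, h1, h2]
    · simp [pairs, h]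

section

variable {p q : ℕ}

theorem truncId_apply (hqp : q ≤ p) (i : Fin p) (j : Fin q) :
    truncId p q i j = (1 : Matrix (Fin p) (Fin p) ℂ) i (Fin.castLE hqp j) := by
  simp [truncId, Matrix.one_apply, Fin.ext_iff]

theorem truncId_transpose_mul_mul (hqp : q ≤ p) (l : Matrix (Fin p) (Fin p) ℂ) (i j : Fin q) :
    ((truncId p q)ᵀ * l * truncId p q) i j = l (Fin.castLE hqp i) (Fin.castLE hqp j) := by
  simp [Matrix.mul_apply, truncId_apply hqp, Matrix.one_apply]

theorem one_castLE (hqp : q ≤ p) (i j : Fin q) :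
    (1 : Matrix (Fin p) (Fin p) ℂ) (Fin.castLE hqp i) (Fin.castLE hqp j)
      = (1 : Matrix (Fin q) (Fin q) ℂ) i j := by
  simp [Matrix.one_apply]

theorem zUpper_eq (a : Fin p × Fin p) :
    zUpper p q a = Matrix.single (Sum.inl a.1) (Sum.inl a.2) 1
      - Matrix.single (Sum.inl a.2) (Sum.inl a.1) 1 := by
  ext (i | i) (j | j) <;> simp [zUpper, elemSkew, Matrix.single_apply]

theorem zLower_eq (a : Fin q × Fin q) :
    zLower p q a = Matrix.single (Sum.inr a.1) (Sum.inr a.2) 1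
      - Matrix.single (Sum.inr a.2) (Sum.inr a.1) 1 := by
  ext (i | i) (j | j) <;> simp [zLower, elemSkew, Matrix.single_apply]

theorem sMat_eq (b : Fin p × Fin q) :
    sMat p q b = Matrix.single (Sum.inl b.1) (Sum.inr b.2) 1
      + Matrix.single (Sum.inr b.2) (Sum.inl b.1) 1 := by
  ext (i | i) (j | j) <;> simp [sMat, Matrix.single_apply]

theorem zUpper_swap (i j : Fin p) : zUpper p q (j, i) = -zUpper p q (i, j) := by
  simp [zUpper_eq]

theorem zLower_swap (i j : Fin q) : zLower p q (j, i) = -zLower p q (i, j) := by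
  simp [zLower_eq]

/-- Inverting both spectral parameters and changing the sign leaves the weight of `P_p` unchanged
and replaces the numerator `λ²` in the weight of `P_f` by `μ²`. -/
theorem rBody_eq {lam mu : ℂ} (hlam : lam ≠ 0) (hmu : mu ≠ 0) (hne : lam ^ 2 ≠ mu ^ 2) :
    rBody p q lam mu = (-mu ^ 2 / (lam ^ 2 - mu ^ 2)) • casimirF p q
      + (lam * mu / (lam ^ 2 - mu ^ 2)) • casimirP p q := by
  have h1 : lam ^ 2 - mu ^ 2 ≠ 0 := sub_ne_zero.2 hne
  have h2 : mu ^ 2 - lam ^ 2 ≠ 0 := sub_ne_zero.2 hne.symm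
  have h3 : lam⁻¹ ^ 2 - mu⁻¹ ^ 2 = (mu ^ 2 - lam ^ 2) / (lam ^ 2 * mu ^ 2) := by
    field_simp
  rw [rBody, rRest, neg_add, ← neg_smul, ← neg_smul, h3]
  congr 2
  · rw [div_div_eq_mul_div, neg_neg, ← neg_sub (lam ^ 2)]
    field_simp
  · rw [div_div_eq_mul_div, ← neg_sub (lam ^ 2)]
    field_simp

/-- Contracting the second factor of `∑ Z_α ⊗ Z_α` with fixed indices returns one basis matrix. The
Kowalevski correction drops out, because its second factors all lie in the lower block. -/
theorem tensorSlice_rKow_upper {lam mu : ℂ} (hlam : lam ≠ 0) (hmu : mu ≠ 0)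
    (hne : lam ^ 2 ≠ mu ^ 2) (b d : Fin p) :
    tensorSlice (Sum.inl b) (Sum.inl d) (rKow p q lam mu)
      = (-mu ^ 2 / (lam ^ 2 - mu ^ 2)) • zUpper p q (b, d) := by
  rw [rKow, rBody_eq hlam hmu hne, kowCorrection, casimirF, casimirP]
  simp only [tensorSlice_sub, tensorSlice_add, tensorSlice_smul, tensorSlice_sum,
    tensorSlice_kronecker, zUpper, zLower, sMat, Matrix.fromBlocks_apply₁₁, Matrix.zero_apply,
    zero_smul, Finset.sum_const_zero, smul_zero, add_zero, sub_zero]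
  rw [← zUpper, ← sum_pairs_elemSkew_smul (zUpper p q) zUpper_swap b d]
  rfl

/-- Here the correction contributes twice: the summand `so(q)` gives its own basis element, and the
summand `so(p)` gives the element of which `Z_α'` is the copy. -/
theorem tensorSlice_rKow_lower (hqp : q ≤ p) {lam mu : ℂ} (hlam : lam ≠ 0) (hmu : mu ≠ 0)
    (hne : lam ^ 2 ≠ mu ^ 2) (b d : Fin q) :
    tensorSlice (Sum.inr b) (Sum.inr d) (rKow p q lam mu)
      = (-mu ^ 2 / (lam ^ 2 - mu ^ 2)) • zLower p q (b, d)
        - (zUpper p q (Fin.castLE hqp b, Fin.castLE hqp d) + zLower p q (b, d)) := by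
  rw [rKow, rBody_eq hlam hmu hne, kowCorrection, casimirF, casimirP]
  rw [← sum_pairs_elemSkew_smul (zUpper p q) zUpper_swap,
    ← sum_pairs_elemSkew_smul (zLower p q) zLower_swap]
  simp only [tensorSlice_sub, tensorSlice_add, tensorSlice_smul, tensorSlice_sum,
    tensorSlice_kronecker, zUpper, zLower, sMat, Matrix.fromBlocks_apply₂₂, Matrix.zero_apply,
    zero_smul, Finset.sum_const_zero, smul_zero, add_zero, zero_add,
    truncId_transpose_mul_mul hqp]

theorem sum_single_smul_sMat (b : Fin p) (d : Fin q) :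
    ∑ e : Fin p × Fin q, Matrix.single e.1 e.2 (1 : ℂ) b d • sMat p q e = sMat p q (b, d) := by
  rw [Finset.sum_eq_single (b, d)]
  · simp
  · rintro ⟨e, f⟩ - hne
    rw [Matrix.single_apply, if_neg, zero_smul]
    rintro ⟨rfl, rfl⟩
    exact hne rfl
  · simp

theorem tensorSlice_rKow_upper_lower {lam mu : ℂ} (hlam : lam ≠ 0) (hmu : mu ≠ 0)
    (hne : lam ^ 2 ≠ mu ^ 2) (b : Fin p) (d : Fin q) :
    tensorSlice (Sum.inl b) (Sum.inr d) (rKow p q lam mu)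
      = (lam * mu / (lam ^ 2 - mu ^ 2)) • sMat p q (b, d) := by
  rw [rKow, rBody_eq hlam hmu hne, kowCorrection, casimirF, casimirP, ← sum_single_smul_sMat b d]
  simp only [tensorSlice_sub, tensorSlice_add, tensorSlice_smul, tensorSlice_sum,
    tensorSlice_kronecker, zUpper, zLower, sMat, Matrix.fromBlocks_apply₁₂, Matrix.zero_apply,
    zero_smul, Finset.sum_const_zero, smul_zero, add_zero, sub_zero, zero_add]

theorem tensorSlice_rKow_lower_upper {lam mu : ℂ} (hlam : lam ≠ 0) (hmu : mu ≠ 0)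
    (hne : lam ^ 2 ≠ mu ^ 2) (b : Fin p) (d : Fin q) :
    tensorSlice (Sum.inr d) (Sum.inl b) (rKow p q lam mu)
      = (lam * mu / (lam ^ 2 - mu ^ 2)) • sMat p q (b, d) := by
  rw [rKow, rBody_eq hlam hmu hne, kowCorrection, casimirF, casimirP, ← sum_single_smul_sMat b d]
  simp only [tensorSlice_sub, tensorSlice_add, tensorSlice_smul, tensorSlice_sum,
    tensorSlice_kronecker, zUpper, zLower, sMat, Matrix.fromBlocks_apply₂₁, Matrix.zero_apply,
    zero_smul, Finset.sum_const_zero, smul_zero, add_zero, sub_zero, zero_add]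
  congr 1
  refine Finset.sum_congr rfl fun e _ => ?_
  simp [Matrix.single_apply, and_comm]

end

/-! ### The Lie-Poisson algebra of the coefficients and the r-matrix relation -/

section

variable {p q : ℕ}

/-- The coefficient functions `ℓ`, `v = (1 - c ℓ) u`, `w = uᵀ ℓ u` with `uᵀ u = h` constant generate
a finite-dimensional Lie algebra under the bracket. -/
structure IsTopAlgebra {X : Type*} (pb : (X → ℂ) → (X → ℂ) → X → ℂ) (S : Subalgebra ℂ (X → ℂ))
    (c : ℂ) (h : Matrix (Fin q) (Fin q) ℂ) (l : X → Matrix (Fin p) (Fin p) ℂ)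
    (v : X → Matrix (Fin p) (Fin q) ℂ) (w : X → Matrix (Fin q) (Fin q) ℂ) : Prop where
  bider : IsBiderivationOn pb S
  symm_h : ∀ a b, h a b = h b a
  l_mem : ∀ i j, (fun y => l y i j) ∈ S
  v_mem : ∀ i j, (fun y => v y i j) ∈ S
  w_mem : ∀ i j, (fun y => w y i j) ∈ S
  l_skew : ∀ x i j, l x i j = -l x j i
  w_skew : ∀ x i j, w x i j = -w x j i
  ll : ∀ x i j m n, pb (fun y => l y i j) (fun y => l y m n) x
    = (1 : Matrix (Fin p) (Fin p) ℂ) i n * l x j m + (1 : Matrix (Fin p) (Fin p) ℂ) j m * l x i n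
      - (1 : Matrix (Fin p) (Fin p) ℂ) i m * l x j n - (1 : Matrix (Fin p) (Fin p) ℂ) j n * l x i m
  lv : ∀ x i j m a, pb (fun y => l y i j) (fun y => v y m a) x
    = (1 : Matrix (Fin p) (Fin p) ℂ) j m * v x i a - (1 : Matrix (Fin p) (Fin p) ℂ) i m * v x j a
  lw : ∀ x i j a b, pb (fun y => l y i j) (fun y => w y a b) x = 0
  vv : ∀ x i a j b, pb (fun y => v y i a) (fun y => v y j b) x
    = c ^ 2 * (l x i j * h a b - (1 : Matrix (Fin p) (Fin p) ℂ) i j * w x a b)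
  vw : ∀ x i a b e, pb (fun y => v y i a) (fun y => w y b e) x = h a e * v x i b - h a b * v x i e
  ww : ∀ x a b d e, pb (fun y => w y a b) (fun y => w y d e) x
    = h a d * w x b e - h b d * w x a e + h a e * w x d b - h b e * w x d a

/-- The matrix `λ (0, E; Eᵀ, 0) - diag(ℓ, -Eᵀ ℓ E) + λ⁻¹ (0, v; vᵀ, 0) + c² λ⁻² diag(0, w)`. -/
noncomputable def laxNumerator (c : ℂ) (l : Matrix (Fin p) (Fin p) ℂ) (v : Matrix (Fin p) (Fin q) ℂ)
    (w : Matrix (Fin q) (Fin q) ℂ) (lam : ℂ) : Matrix (Fin p ⊕ Fin q) (Fin p ⊕ Fin q) ℂ :=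
  lam • Matrix.fromBlocks 0 (truncId p q) (truncId p q)ᵀ 0
    - Matrix.fromBlocks l 0 0 (-((truncId p q)ᵀ * l * truncId p q))
    + lam⁻¹ • Matrix.fromBlocks 0 v vᵀ 0 + (c ^ 2 / lam ^ 2) • Matrix.fromBlocks 0 0 0 w

section Entries

variable (c : ℂ) (l : Matrix (Fin p) (Fin p) ℂ) (v : Matrix (Fin p) (Fin q) ℂ)
  (w : Matrix (Fin q) (Fin q) ℂ) (lam : ℂ)

theorem laxNumerator_inl_inl (a b : Fin p) :
    laxNumerator c l v w lam (Sum.inl a) (Sum.inl b) = -l a b := by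
  simp [laxNumerator]

theorem laxNumerator_inl_inr (hqp : q ≤ p) (a : Fin p) (b : Fin q) :
    laxNumerator c l v w lam (Sum.inl a) (Sum.inr b)
      = lam * (1 : Matrix (Fin p) (Fin p) ℂ) a (Fin.castLE hqp b) + lam⁻¹ * v a b := by
  simp [laxNumerator, truncId_apply hqp]

theorem laxNumerator_inr_inl (hqp : q ≤ p) (a : Fin p) (b : Fin q) :
    laxNumerator c l v w lam (Sum.inr b) (Sum.inl a)
      = lam * (1 : Matrix (Fin p) (Fin p) ℂ) a (Fin.castLE hqp b) + lam⁻¹ * v a b := by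
  simp [laxNumerator, truncId_apply hqp]

theorem laxNumerator_inr_inr (hqp : q ≤ p) (a b : Fin q) :
    laxNumerator c l v w lam (Sum.inr a) (Sum.inr b)
      = l (Fin.castLE hqp a) (Fin.castLE hqp b) + c ^ 2 / lam ^ 2 * w a b := by
  simp [laxNumerator, truncId_transpose_mul_mul hqp]

end Entries

/-- The matrix `1 + s diag(0, h)`. -/
noncomputable def dressing (p : ℕ) (h : Matrix (Fin q) (Fin q) ℂ) (s : ℂ) :
    Matrix (Fin p ⊕ Fin q) (Fin p ⊕ Fin q) ℂ :=
  1 + s • Matrix.fromBlocks 0 0 0 h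

section Entries

variable (h : Matrix (Fin q) (Fin q) ℂ) (s : ℂ)

theorem dressing_inl_inl (a b : Fin p) :
    dressing p h s (Sum.inl a) (Sum.inl b) = (1 : Matrix (Fin p) (Fin p) ℂ) a b := by
  simp [dressing, Matrix.one_apply]

theorem dressing_inl_inr (a : Fin p) (b : Fin q) :
    dressing p h s (Sum.inl a) (Sum.inr b) = 0 := by
  simp [dressing]

theorem dressing_inr_inl (a : Fin p) (b : Fin q) :
    dressing p h s (Sum.inr b) (Sum.inl a) = 0 := by
  simp [dressing]

theorem dressing_inr_inr (a b : Fin q) :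
    dressing p h s (Sum.inr a) (Sum.inr b) = (1 : Matrix (Fin q) (Fin q) ℂ) a b + s * h a b := by
  simp [dressing, Matrix.one_apply]

end Entries

theorem one_apply_comm {n : Type*} [DecidableEq n] (a b : n) :
    (1 : Matrix n n ℂ) a b = (1 : Matrix n n ℂ) b a := by
  simp [Matrix.one_apply, eq_comm]

/-! ### Entries of the dressed commutators, by the block of the second factor. -/

section Commutators

variable (hqp : q ≤ p) {lam mu : ℂ} (hlam : lam ≠ 0) (hmu : mu ≠ 0) (hne : lam ^ 2 ≠ mu ^ 2)
  (H N : Matrix (Fin p ⊕ Fin q) (Fin p ⊕ Fin q) ℂ) (a c : Fin p ⊕ Fin q)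

include hlam hmu hne

theorem dressedCommutator_rKow_upper (b d : Fin p) :
    dressedCommutator (rKow p q lam mu) H N (a, Sum.inl b) (c, Sum.inl d)
      = -mu ^ 2 / (lam ^ 2 - mu ^ 2) * (H a (Sum.inl b) * N (Sum.inl d) c
          - H a (Sum.inl d) * N (Sum.inl b) c - N a (Sum.inl b) * H (Sum.inl d) c
          + N a (Sum.inl d) * H (Sum.inl b) c) := by
  rw [dressedCommutator_apply, tensorSlice_rKow_upper hlam hmu hne, zUpper_eq]
  simp only [Matrix.mul_smul, Matrix.smul_mul, Matrix.mul_sub, Matrix.sub_mul, Matrix.sub_apply,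
    Matrix.smul_apply, mul_single_mul_apply, smul_eq_mul]
  ring

theorem dressedCommutator_rKow_lower (b d : Fin q) :
    dressedCommutator (rKow p q lam mu) H N (a, Sum.inr b) (c, Sum.inr d)
      = (-mu ^ 2 / (lam ^ 2 - mu ^ 2) - 1) * (H a (Sum.inr b) * N (Sum.inr d) c
          - H a (Sum.inr d) * N (Sum.inr b) c - N a (Sum.inr b) * H (Sum.inr d) c
          + N a (Sum.inr d) * H (Sum.inr b) c)
        - (H a (Sum.inl (Fin.castLE hqp b)) * N (Sum.inl (Fin.castLE hqp d)) c
          - H a (Sum.inl (Fin.castLE hqp d)) * N (Sum.inl (Fin.castLE hqp b)) c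
          - N a (Sum.inl (Fin.castLE hqp b)) * H (Sum.inl (Fin.castLE hqp d)) c
          + N a (Sum.inl (Fin.castLE hqp d)) * H (Sum.inl (Fin.castLE hqp b)) c) := by
  rw [dressedCommutator_apply, tensorSlice_rKow_lower hqp hlam hmu hne, zUpper_eq, zLower_eq]
  simp only [Matrix.mul_smul, Matrix.smul_mul, Matrix.mul_sub, Matrix.sub_mul, Matrix.sub_apply,
    Matrix.mul_add, Matrix.add_mul, Matrix.add_apply, Matrix.smul_apply, mul_single_mul_apply,
    smul_eq_mul]
  ring

theorem dressedCommutator_rKow_upper_lower (b : Fin p) (d : Fin q) :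
    dressedCommutator (rKow p q lam mu) H N (a, Sum.inl b) (c, Sum.inr d)
      = lam * mu / (lam ^ 2 - mu ^ 2) * (H a (Sum.inl b) * N (Sum.inr d) c
          + H a (Sum.inr d) * N (Sum.inl b) c - N a (Sum.inl b) * H (Sum.inr d) c
          - N a (Sum.inr d) * H (Sum.inl b) c) := by
  rw [dressedCommutator_apply, tensorSlice_rKow_upper_lower hlam hmu hne, sMat_eq]
  simp only [Matrix.mul_smul, Matrix.smul_mul, Matrix.mul_add, Matrix.add_mul, Matrix.sub_apply,
    Matrix.add_apply, Matrix.smul_apply, mul_single_mul_apply, smul_eq_mul]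
  ring

theorem dressedCommutator_rKow_lower_upper (b : Fin p) (d : Fin q) :
    dressedCommutator (rKow p q lam mu) H N (a, Sum.inr d) (c, Sum.inl b)
      = lam * mu / (lam ^ 2 - mu ^ 2) * (H a (Sum.inl b) * N (Sum.inr d) c
          + H a (Sum.inr d) * N (Sum.inl b) c - N a (Sum.inl b) * H (Sum.inr d) c
          - N a (Sum.inr d) * H (Sum.inl b) c) := by
  rw [dressedCommutator_apply, tensorSlice_rKow_lower_upper hlam hmu hne, sMat_eq]
  simp only [Matrix.mul_smul, Matrix.smul_mul, Matrix.mul_add, Matrix.add_mul, Matrix.sub_apply,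
    Matrix.add_apply, Matrix.smul_apply, mul_single_mul_apply, smul_eq_mul]
  ring

end Commutators

namespace IsTopAlgebra

variable {X : Type*} {pb : (X → ℂ) → (X → ℂ) → X → ℂ} {S : Subalgebra ℂ (X → ℂ)}
    {c : ℂ} {h : Matrix (Fin q) (Fin q) ℂ} {l : X → Matrix (Fin p) (Fin p) ℂ}
    {v : X → Matrix (Fin p) (Fin q) ℂ} {w : X → Matrix (Fin q) (Fin q) ℂ}
    (ht : IsTopAlgebra pb S c h l v w)

include ht

theorem laxNumerator_mem (hqp : q ≤ p) (lam : ℂ) (i j : Fin p ⊕ Fin q) :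
    (fun y => laxNumerator c (l y) (v y) (w y) lam i j) ∈ S := by
  rcases i with i | i <;> rcases j with j | j
  · simp only [laxNumerator_inl_inl]
    exact neg_mem_fun (ht.l_mem i j)
  · simp only [laxNumerator_inl_inr c _ _ _ _ hqp]
    exact add_mem_fun (const_mem_fun S _) (const_mul_mem_fun _ (ht.v_mem _ _))
  · simp only [laxNumerator_inr_inl c _ _ _ _ hqp]
    exact add_mem_fun (const_mem_fun S _) (const_mul_mem_fun _ (ht.v_mem _ _))
  · simp only [laxNumerator_inr_inr c _ _ _ _ hqp]
    exact add_mem_fun (ht.l_mem _ _) (const_mul_mem_fun _ (ht.w_mem _ _))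

theorem vl (x i j m a) : pb (fun y => v y m a) (fun y => l y i j) x
    = (1 : Matrix (Fin p) (Fin p) ℂ) i m * v x j a
      - (1 : Matrix (Fin p) (Fin p) ℂ) j m * v x i a := by
  rw [ht.bider.symm _ (ht.v_mem _ _) _ (ht.l_mem _ _), ht.lv, neg_sub]

theorem wl (x i j a b) : pb (fun y => w y a b) (fun y => l y i j) x = 0 := by
  rw [ht.bider.symm _ (ht.w_mem _ _) _ (ht.l_mem _ _), ht.lw, neg_zero]

theorem wv (x i a b e) : pb (fun y => w y b e) (fun y => v y i a) x
    = h a b * v x i e - h a e * v x i b := by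
  rw [ht.bider.symm _ (ht.w_mem _ _) _ (ht.v_mem _ _), ht.vw, neg_sub]

/-- This is the heart of the r-matrix relation. Both sides are affine in `ℓ`, `v`, `w`, and in each
of the 16 block positions they agree as rational functions of `λ` and `μ`. -/
theorem bracket_laxNumerator (hqp : q ≤ p) {lam mu : ℂ} (hlam : lam ≠ 0) (hmu : mu ≠ 0)
    (hne : lam ^ 2 ≠ mu ^ 2) (x : X) (a b e d : Fin p ⊕ Fin q) :
    pb (fun y => laxNumerator c (l y) (v y) (w y) lam a e)
        (fun y => laxNumerator c (l y) (v y) (w y) mu b d) x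
      = dressedCommutator (rKow p q mu lam) (dressing p h (c ^ 2 / mu ^ 2))
          (laxNumerator c (l x) (v x) (w x) mu) (b, a) (d, e)
        - dressedCommutator (rKow p q lam mu) (dressing p h (c ^ 2 / lam ^ 2))
          (laxNumerator c (l x) (v x) (w x) lam) (a, b) (e, d) := by
  have h1 : lam ^ 2 - mu ^ 2 ≠ 0 := sub_ne_zero.2 hne
  -- The kernels at `(λ, μ)` and `(μ, λ)` get one common denominator.
  have h2 : mu ^ 2 - lam ^ 2 = -(lam ^ 2 - mu ^ 2) := by ring
  have hN1 := laxNumerator_inl_inl (p := p) (q := q) c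
  have hN2 (l) (v) (w) (lam) := laxNumerator_inl_inr c l v w lam hqp
  have hN3 (l) (v) (w) (lam) := laxNumerator_inr_inl c l v w lam hqp
  have hN4 (l) (v) (w) (lam) := laxNumerator_inr_inr c l v w lam hqp
  have hb := ht.bider
  have hl := ht.l_mem
  have hv := ht.v_mem
  have hw := ht.w_mem
  have hsv (s : ℂ) (i j) := const_mul_mem_fun s (hv i j)
  have hsw (s : ℂ) (i j) := const_mul_mem_fun s (hw i j)
  have hav (k s : ℂ) (i j) := add_mem_fun (const_mem_fun S k) (hsv s i j)
  have haw (m n) (s : ℂ) (i j) := add_mem_fun (hl m n) (hsw s i j)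
  -- The constant `k` stands for an entry of `λ E`, which is central for the bracket.
  have bv (k s : ℂ) (m a) (g) (hg : g ∈ S) :
      pb (fun y => k + s * v y m a) g x = s * pb (fun y => v y m a) g x := by
    rw [hb.add_left _ (const_mem_fun S k) _ (hsv s m a) _ hg, hb.const_left k g hg,
      hb.const_mul_left x s (hv m a) hg, zero_add]
  have bv' (k s : ℂ) (m a) (g) (hg : g ∈ S) :
      pb g (fun y => k + s * v y m a) x = s * pb g (fun y => v y m a) x := by
    rw [hb.symm _ hg _ (hav k s m a), bv k s m a g hg, hb.symm _ hg _ (hv m a), mul_neg]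
  have bw (i j) (s : ℂ) (a b) (g) (hg : g ∈ S) : pb (fun y => l y i j + s * w y a b) g x
      = pb (fun y => l y i j) g x + s * pb (fun y => w y a b) g x := by
    rw [hb.add_left _ (hl i j) _ (hsw s a b) _ hg, hb.const_mul_left x s (hw a b) hg]
  have bw' (i j) (s : ℂ) (a b) (g) (hg : g ∈ S) : pb g (fun y => l y i j + s * w y a b) x
      = pb g (fun y => l y i j) x + s * pb g (fun y => w y a b) x := by
    rw [hb.add_right x hg (hl i j) (hsw s a b), hb.const_mul_right x s hg (hw a b)]
  have bl (i j) (g) (hg : g ∈ S) := hb.neg_left x (hl i j) hg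
  have bl' (i j) (g) (hg : g ∈ S) := hb.neg_right x hg (hl i j)
  -- Writing `ℓ` and `w` as antisymmetrizations of free matrices builds skew symmetry into the
  -- expressions, so that `ring` needs no relation between different entries.
  obtain ⟨ls, hls⟩ : ∃ ls : Fin p → Fin p → ℂ, ∀ i j, l x i j = ls i j - ls j i :=
    ⟨fun i j => l x i j / 2, fun i j => by linear_combination ht.l_skew x i j / 2⟩
  obtain ⟨ws, hws⟩ : ∃ ws : Fin q → Fin q → ℂ, ∀ i j, w x i j = ws i j - ws j i :=
    ⟨fun i j => w x i j / 2, fun i j => by linear_combination ht.w_skew x i j / 2⟩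
  rcases a with a | a <;> rcases b with b | b <;> rcases e with e | e <;> rcases d with d | d <;>
  simp only [dressedCommutator_rKow_upper hmu hlam hne.symm,
    dressedCommutator_rKow_upper hlam hmu hne,
    dressedCommutator_rKow_upper_lower hmu hlam hne.symm,
    dressedCommutator_rKow_upper_lower hlam hmu hne,
    dressedCommutator_rKow_lower_upper hmu hlam hne.symm,
    dressedCommutator_rKow_lower_upper hlam hmu hne,
    dressedCommutator_rKow_lower hqp hmu hlam hne.symm,
    dressedCommutator_rKow_lower hqp hlam hmu hne,
    hN1, hN2, hN3, hN4, dressing_inl_inl, dressing_inl_inr, dressing_inr_inl, dressing_inr_inr, h2,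
    bl _ _ _ (neg_mem_fun (hl _ _)), bl _ _ _ (hav _ _ _ _), bl _ _ _ (haw _ _ _ _ _),
    bv _ _ _ _ _ (neg_mem_fun (hl _ _)), bv _ _ _ _ _ (hav _ _ _ _),
    bv _ _ _ _ _ (haw _ _ _ _ _),
    bw _ _ _ _ _ _ (neg_mem_fun (hl _ _)), bw _ _ _ _ _ _ (hav _ _ _ _),
    bw _ _ _ _ _ _ (haw _ _ _ _ _),
    bl' _ _ _ (hl _ _), bl' _ _ _ (hv _ _), bl' _ _ _ (hw _ _),
    bv' _ _ _ _ _ (hl _ _), bv' _ _ _ _ _ (hv _ _), bv' _ _ _ _ _ (hw _ _),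
    bw' _ _ _ _ _ _ (hl _ _), bw' _ _ _ _ _ _ (hv _ _), bw' _ _ _ _ _ _ (hw _ _),
    ht.ll, ht.lv, ht.lw, ht.vl, ht.vv, ht.vw, ht.wl, ht.wv, ht.ww, hls, hws, one_castLE] <;>
  -- These permutation rules bring the two indices of each Kronecker delta and of each `h` into one
  -- order, so that equal quantities become equal atoms.
  simp only [one_apply_comm, ht.symm_h] <;>
  field_simp <;>
  ring

end IsTopAlgebra

end

/-! ### Closure of the brackets of `ℓ`, `v` and `w`. -/

section

variable {p q : ℕ} {X : Type*} {pb : (X → ℂ) → (X → ℂ) → X → ℂ} {S : Subalgebra ℂ (X → ℂ)}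

/-- The brackets of the functions `ℓ`, `v = (1 - c ℓ) u` and `w = uᵀ ℓ u`, computed from those of
`ℓ` and `u`. -/
theorem isTopAlgebra_of_semidirect (hb : IsBiderivationOn pb S) (c : ℂ)
    {h : Matrix (Fin q) (Fin q) ℂ} {l : X → Matrix (Fin p) (Fin p) ℂ}
    {u : X → Matrix (Fin p) (Fin q) ℂ} (hl : ∀ i j, (fun y => l y i j) ∈ S)
    (hu : ∀ i j, (fun y => u y i j) ∈ S) (l_skew : ∀ x i j, l x i j = -l x j i)
    (hh : ∀ x a b, ∑ m, u x m a * u x m b = h a b) (symm_h : ∀ a b, h a b = h b a)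
    (ll : ∀ x i j m n, pb (fun y => l y i j) (fun y => l y m n) x
      = (1 : Matrix (Fin p) (Fin p) ℂ) i n * l x j m + (1 : Matrix (Fin p) (Fin p) ℂ) j m * l x i n
      - (1 : Matrix (Fin p) (Fin p) ℂ) i m * l x j n
      - (1 : Matrix (Fin p) (Fin p) ℂ) j n * l x i m)
    (lu : ∀ x i j m a, pb (fun y => l y i j) (fun y => u y m a) x
      = (1 : Matrix (Fin p) (Fin p) ℂ) j m * u x i a - (1 : Matrix (Fin p) (Fin p) ℂ) i m * u x j a)
    (uu : ∀ x i a j b, pb (fun y => u y i a) (fun y => u y j b) x = 0) :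
    IsTopAlgebra pb S c h l (fun x => (1 - c • l x) * u x) (fun x => (u x)ᵀ * l x * u x) := by
  have hlu (i m a) : (fun y => l y i m * u y m a) ∈ S := mul_mem_fun (hl i m) (hu m a)
  -- With `s = ℓ u` one has `v = u - c s` and `w = uᵀ s`, so all brackets follow from those of `ℓ`,
  -- `u`, `s`, `w` by the Leibniz rule.
  let s : X → Fin p → Fin q → ℂ := fun y i a => ∑ m, l y i m * u y m a
  have hs (i a) : (fun y => s y i a) ∈ S := sum_mem_fun _ fun m => hlu i m a
  let w : X → Fin q → Fin q → ℂ := fun y a b => ∑ m, u y m a * s y m b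
  have hus (a b m) : (fun y => u y m a * s y m b) ∈ S := mul_mem_fun (hu m a) (hs m b)
  have hw (a b) : (fun y => w y a b) ∈ S := sum_mem_fun _ fun m => hus a b m
  have w_skew (x a b) : w x a b = -w x b a := by
    simp only [w, s, Finset.mul_sum]
    rw [Finset.sum_comm, ← Finset.sum_neg_distrib]
    refine Finset.sum_congr rfl fun i _ => ?_
    rw [← Finset.sum_neg_distrib]
    refine Finset.sum_congr rfl fun j _ => ?_
    rw [l_skew x j i]
    ring
  have su_sum (x a b) : ∑ m, s x m a * u x m b = w x b a :=
    Finset.sum_congr rfl fun m _ => mul_comm _ _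
  have ul (x i j m a) : pb (fun y => u y m a) (fun y => l y i j) x
      = (1 : Matrix (Fin p) (Fin p) ℂ) i m * u x j a
        - (1 : Matrix (Fin p) (Fin p) ℂ) j m * u x i a := by
    rw [hb.symm _ (hu m a) _ (hl i j), lu, neg_sub]
  -- Like `u`, the columns of `s` transform as vectors: the terms in which the contracted index is
  -- rotated cancel by skew symmetry of `ℓ`. In `key` the terms are sorted by their deltas so that
  -- the sum collapses.
  have ls (x i j m a) : pb (fun y => l y i j) (fun y => s y m a) x
      = (1 : Matrix (Fin p) (Fin p) ℂ) j m * s x i a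
        - (1 : Matrix (Fin p) (Fin p) ℂ) i m * s x j a := by
    have key (n) : pb (fun y => l y i j) (fun y => l y m n * u y n a) x
        = (1 : Matrix (Fin p) (Fin p) ℂ) j m * (l x i n * u x n a)
          - (1 : Matrix (Fin p) (Fin p) ℂ) i m * (l x j n * u x n a)
          + ((1 : Matrix (Fin p) (Fin p) ℂ) i n * (l x j m * u x n a + l x m n * -u x j a)
            + (1 : Matrix (Fin p) (Fin p) ℂ) j n * (-l x i m * u x n a + l x m n * u x i a)) := by
      rw [hb.mul_right x (hl i j) (hl m n) (hu n a), lu, ll]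
      ring
    simp only [s]
    rw [hb.sum_right x _ (hl i j) (hlu m · a)]
    simp only [key, Finset.sum_add_distrib, Finset.sum_sub_distrib, ← Finset.mul_sum]
    simp only [Matrix.one_apply, ite_mul, one_mul, zero_mul, Finset.sum_ite_eq, Finset.mem_univ,
      if_true, l_skew x m j, l_skew x m i]
    ring
  have sl (x i j m a) : pb (fun y => s y m a) (fun y => l y i j) x
      = (1 : Matrix (Fin p) (Fin p) ℂ) i m * s x j a
        - (1 : Matrix (Fin p) (Fin p) ℂ) j m * s x i a := by
    rw [hb.symm _ (hs m a) _ (hl i j), ls, neg_sub]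
  -- The contraction `∑ u_{ma} u_{mb}` appears here and is replaced by the constant `h`.
  have su (x i a j b) : pb (fun y => s y i a) (fun y => u y j b) x
      = u x i b * u x j a - (1 : Matrix (Fin p) (Fin p) ℂ) i j * h a b := by
    have key (m) : pb (fun y => l y i m * u y m a) (fun y => u y j b) x
        = (1 : Matrix (Fin p) (Fin p) ℂ) j m * (u x m a * u x i b)
          - (1 : Matrix (Fin p) (Fin p) ℂ) i j * (u x m a * u x m b) := by
      rw [hb.mul_left _ (hl i m) _ (hu m a) _ (hu j b), lu, uu, one_apply_comm m j]
      ring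
    simp only [s]
    rw [hb.sum_left x _ (hlu i · a) (hu j b)]
    simp only [key, Finset.sum_sub_distrib, ← Finset.mul_sum, hh]
    simp only [Matrix.one_apply, ite_mul, one_mul, zero_mul, Finset.sum_ite_eq, Finset.mem_univ,
      if_true]
    ring
  have us (x i a j b) : pb (fun y => u y j b) (fun y => s y i a) x
      = (1 : Matrix (Fin p) (Fin p) ℂ) i j * h a b - u x i b * u x j a := by
    rw [hb.symm _ (hu j b) _ (hs i a), su, neg_sub]
  have ss (x i a j b) : pb (fun y => s y i a) (fun y => s y j b) x
      = l x i j * h a b - (1 : Matrix (Fin p) (Fin p) ℂ) i j * w x a b := by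
    have key (m) : pb (fun y => s y i a) (fun y => l y j m * u y m b) x
        = u x i b * (l x j m * u x m a)
          + ((1 : Matrix (Fin p) (Fin p) ℂ) i j * (s x m a * u x m b)
          + (1 : Matrix (Fin p) (Fin p) ℂ) i m * (-l x j m * h a b - u x m b * s x j a)) := by
      rw [hb.mul_right x (hs i a) (hl j m) (hu m b), su, sl, one_apply_comm j i,
        one_apply_comm m i]
      ring
    -- Only the second argument is expanded; the brackets of the unexpanded first `s` with `u` and
    -- `ℓ` are `su` and `sl`.
    conv_lhs => rw [show (fun y => s y j b) = fun y => ∑ m, l y j m * u y m b from rfl]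
    rw [hb.sum_right x _ (hs i a) (hlu j · b)]
    simp only [key, Finset.sum_add_distrib, ← Finset.mul_sum, su_sum]
    simp only [Matrix.one_apply, ite_mul, one_mul, zero_mul, Finset.sum_ite_eq, Finset.mem_univ,
      if_true, l_skew x j i, w_skew x b a]
    simp only [s]
    split_ifs <;> ring
  -- The entries of `w` are scalar products of vectors, hence invariant under the rotations
  -- generated by `ℓ`.
  have lw (x i j a b) : pb (fun y => l y i j) (fun y => w y a b) x = 0 := by
    have key (m) : pb (fun y => l y i j) (fun y => u y m a * s y m b) x
        = (1 : Matrix (Fin p) (Fin p) ℂ) j m * (u x i a * s x m b + u x m a * s x i b)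
          - (1 : Matrix (Fin p) (Fin p) ℂ) i m * (u x j a * s x m b + u x m a * s x j b) := by
      rw [hb.mul_right x (hl i j) (hu m a) (hs m b), lu, ls]
      ring
    simp only [w]
    rw [hb.sum_right x _ (hl i j) (hus a b)]
    simp only [key, Finset.sum_sub_distrib]
    simp only [Matrix.one_apply, ite_mul, one_mul, zero_mul, Finset.sum_ite_eq, Finset.mem_univ,
      if_true]
    ring
  have uw (x i a b e) : pb (fun y => u y i a) (fun y => w y b e) x
      = h a e * u x i b - h a b * u x i e := by
    have key (m) : pb (fun y => u y i a) (fun y => u y m b * s y m e) x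
        = (1 : Matrix (Fin p) (Fin p) ℂ) i m * (h e a * u x m b)
          - u x i e * (u x m a * u x m b) := by
      rw [hb.mul_right x (hu i a) (hu m b) (hs m e), uu, us, one_apply_comm m i]
      ring
    simp only [w]
    rw [hb.sum_right x _ (hu i a) (hus b e)]
    simp only [key, Finset.sum_sub_distrib, ← Finset.mul_sum, hh]
    simp only [Matrix.one_apply, ite_mul, one_mul, zero_mul, Finset.sum_ite_eq, Finset.mem_univ,
      if_true, symm_h e a]
    ring
  have sw (x i a b e) : pb (fun y => s y i a) (fun y => w y b e) x
      = h a e * s x i b - h a b * s x i e := by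
    have key (m) : pb (fun y => l y i m * u y m a) (fun y => w y b e) x
        = h a e * (l x i m * u x m b) - h a b * (l x i m * u x m e) := by
      rw [hb.mul_left _ (hl i m) _ (hu m a) _ (hw b e), lw, uw]
      ring
    conv_lhs => rw [show (fun y => s y i a) = fun y => ∑ m, l y i m * u y m a from rfl]
    rw [hb.sum_left x _ (hlu i · a) (hw b e)]
    simp only [key, Finset.sum_sub_distrib, ← Finset.mul_sum, s]
  have ww (x a b d e) : pb (fun y => w y a b) (fun y => w y d e) x
      = h a d * w x b e - h b d * w x a e + h a e * w x d b - h b e * w x d a := by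
    have key (m) : pb (fun y => u y m a * s y m b) (fun y => w y d e) x
        = h a e * (u x m d * s x m b) - h a d * (u x m e * s x m b)
          + (h b e * (u x m a * s x m d) - h b d * (u x m a * s x m e)) := by
      rw [hb.mul_left _ (hu m a) _ (hs m b) _ (hw d e), uw, sw]
      ring
    conv_lhs => rw [show (fun y => w y a b) = fun y => ∑ m, u y m a * s y m b from rfl]
    rw [hb.sum_left x _ (hus a b) (hw d e)]
    simp only [key, Finset.sum_sub_distrib, Finset.sum_add_distrib, ← Finset.mul_sum]
    change h a e * w x d b - h a d * w x e b + (h b e * w x a d - h b d * w x a e) = _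
    rw [w_skew x e b, w_skew x a d]
    ring
  have hcs (i a) := const_mul_mem_fun c (hs i a)
  have hv (i a) : (fun y => u y i a - c * s y i a) ∈ S := sub_mem_fun (hu i a) (hcs i a)
  have v_eq (x i a) : ((1 - c • l x) * u x : Matrix (Fin p) (Fin q) ℂ) i a = u x i a - c * s x i a := by
    rw [Matrix.sub_mul, Matrix.one_mul, Matrix.smul_mul]
    simp [Matrix.mul_apply, s]
  have w_eq (x a b) : ((u x)ᵀ * l x * u x) a b = w x a b := by
    rw [Matrix.mul_assoc]
    simp [Matrix.mul_apply, w, s]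
  refine ⟨hb, symm_h, hl, ?_, ?_, l_skew, ?_, ll, ?_, ?_, ?_, ?_, ?_⟩
  · simpa only [v_eq] using hv
  · simpa only [w_eq] using hw
  · simpa only [w_eq] using w_skew
  · intro x i j m a
    simp only [v_eq]
    rw [hb.sub_right x (hl i j) (hu m a) (hcs m a), hb.const_mul_right x c (hl i j) (hs m a), lu,
      ls]
    ring
  · simpa only [w_eq] using lw
  -- The terms of first order in `c`, namely `{u, s} + {s, u}`, cancel including their parts
  -- quadratic in `u`; only `c² {s, s}` survives.
  · intro x i a j b
    simp only [v_eq, w_eq]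
    rw [hb.sub_right x (hv i a) (hu j b) (hcs j b), hb.const_mul_right x c (hv i a) (hs j b),
      hb.sub_left x (hu i a) (hcs i a) (hu j b), hb.const_mul_left x c (hs i a) (hu j b),
      hb.sub_left x (hu i a) (hcs i a) (hs j b), hb.const_mul_left x c (hs i a) (hs j b),
      uu, su, us, ss, symm_h b a, one_apply_comm j i]
    ring
  · intro x i a b e
    simp only [v_eq, w_eq]
    rw [hb.sub_left x (hu i a) (hcs i a) (hw b e), hb.const_mul_left x c (hs i a) (hw b e), uw, sw]
    ring
  · simpa only [w_eq] using ww

end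

/-! ### The canonical bracket and the Lie-Poisson bracket -/

section LieBracketCoord

variable {p : ℕ} {l : Matrix (Fin p) (Fin p) ℝ}

theorem lieBracketCoord_symm (hl : ∀ i j, l i j = -l j i) (a b : Fin p × Fin p) :
    lieBracketCoord l a b = -lieBracketCoord l b a := by
  simp only [lieBracketCoord, hl b.2 a.1, hl b.1 a.2, hl b.2 a.2, hl b.1 a.1, @eq_comm _ b.1,
    @eq_comm _ b.2]
  split_ifs <;> ring

theorem lieBracketCoord_swap_left (a b : Fin p × Fin p) :
    lieBracketCoord l a.swap b = -lieBracketCoord l a b := by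
  simp only [lieBracketCoord, Prod.fst_swap, Prod.snd_swap]
  ring

theorem lieBracketCoord_swap_right (a b : Fin p × Fin p) :
    lieBracketCoord l a b.swap = -lieBracketCoord l a b := by
  simp only [lieBracketCoord, Prod.fst_swap, Prod.snd_swap]
  ring

/-- The sum over `i < j` involves independent coordinates only. Antisymmetry of the structure
constants in each index pair extends the result to all pairs, in either order and on the diagonal.
-/
theorem sum_sum_elemSkew_lieBracketCoord (i j m n : Fin p) :
    ∑ a ∈ pairs p, ∑ b ∈ pairs p,
        elemSkew ℂ a i j * elemSkew ℂ b m n * (lieBracketCoord l a b : ℂ)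
      = (lieBracketCoord l (i, j) (m, n) : ℂ) := by
  have h1 (a) : ∑ b ∈ pairs p, elemSkew ℂ a i j * elemSkew ℂ b m n * (lieBracketCoord l a b : ℂ)
      = elemSkew ℂ a i j • (lieBracketCoord l a (m, n) : ℂ) := by
    rw [← sum_pairs_elemSkew_smul (fun b => (lieBracketCoord l a b : ℂ)) (fun i j => by
      have := lieBracketCoord_swap_right (l := l) a (i, j)
      rw [Prod.swap_prod_mk] at this
      rw [this, Complex.ofReal_neg]) m n, Finset.smul_sum]
    refine Finset.sum_congr rfl fun b _ => ?_
    simp only [smul_eq_mul, mul_assoc]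
  simp only [h1]
  refine sum_pairs_elemSkew_smul (fun a => (lieBracketCoord l a (m, n) : ℂ)) (fun i j => ?_) i j
  have := lieBracketCoord_swap_left (l := l) (i, j) (m, n)
  rw [Prod.swap_prod_mk] at this
  rw [this, Complex.ofReal_neg]

theorem ofReal_lieBracketCoord (i j m n : Fin p) :
    (lieBracketCoord l (i, j) (m, n) : ℂ)
      = (1 : Matrix (Fin p) (Fin p) ℂ) i n * l j m + (1 : Matrix (Fin p) (Fin p) ℂ) j m * l i n
        - (1 : Matrix (Fin p) (Fin p) ℂ) i m * l j n
        - (1 : Matrix (Fin p) (Fin p) ℂ) j n * l i m := by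
  simp only [lieBracketCoord, Matrix.one_apply]
  push_cast
  simp only [apply_ite Complex.ofReal, Complex.ofReal_zero, ite_mul, one_mul, zero_mul]

end LieBracketCoord

theorem SkewMat.apply_eq_neg {n : ℕ} (l : SkewMat n) (i j : Fin n) : l.1 i j = -l.1 j i := by
  have := congrFun (congrFun l.2 j) i
  simpa using this

theorem ofReal_elemSkew {n : ℕ} (a : Fin n × Fin n) (i j : Fin n) :
    ((elemSkew ℝ a i j : ℝ) : ℂ) = elemSkew ℂ a i j := by
  simp [elemSkew, Matrix.single_apply, apply_ite Complex.ofReal]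

theorem hasDerivAt_shiftSkew {n : ℕ} (a : Fin n × Fin n) (l : SkewMat n) (i j : Fin n) :
    HasDerivAt (fun t : ℝ => (((shiftSkew a t l).1 i j : ℝ) : ℂ)) (elemSkew ℂ a i j) 0 := by
  rw [← ofReal_elemSkew]
  refine HasDerivAt.ofReal_comp (f := fun t => (shiftSkew a t l).1 i j) ?_
  simpa [shiftSkew] using ((hasDerivAt_id (0 : ℝ)).mul_const (elemSkew ℝ a i j)).const_add (l.1 i j)

theorem shiftSkew_zero {n : ℕ} (a : Fin n × Fin n) (l : SkewMat n) : shiftSkew a 0 l = l := by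
  simp [shiftSkew]

theorem rotation_zero {n : ℕ} (a : Fin n × Fin n) : rotation a 0 = 1 := by
  apply Subtype.ext
  simp [rotation]

-- The operator norm serves only to differentiate the exponential in a normed algebra; the entries
-- are then continuous linear functions of the matrix.
open scoped Matrix.Norms.Operator in
theorem hasDerivAt_rotation_apply {p : ℕ} (a : Fin p × Fin p) (i j : Fin p) :
    HasDerivAt (fun t : ℝ => (rotation a t).1 i j) (elemSkew ℝ a i j) 0 := by
  have h : HasDerivAt (fun t : ℝ => NormedSpace.exp (t • elemSkew ℝ a)) (elemSkew ℝ a) 0 := by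
    have h0 := hasDerivAt_exp_smul_const (𝕂 := ℝ) (elemSkew ℝ a) (0 : ℝ)
    rw [zero_smul, NormedSpace.exp_zero, one_mul] at h0
    exact h0
  exact ((Matrix.entryLinearMap ℝ ℝ i j).toContinuousLinearMap.hasFDerivAt.comp_hasDerivAt 0 h)

theorem hasDerivAt_mul_rotation_apply {p : ℕ} (k : SOGroup p) (a : Fin p × Fin p) (i j : Fin p) :
    HasDerivAt (fun t : ℝ => (((k * rotation a t).1 i j : ℝ) : ℂ))
      ((cplx k.1 * elemSkew ℂ a) i j) 0 := by
  have h := HasDerivAt.fun_sum (u := Finset.univ) fun (m : Fin p) _ =>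
    (hasDerivAt_rotation_apply a m j).const_mul (k.1 i m)
  convert h.ofReal_comp using 1
  · simp [Matrix.mul_apply]
  · simp [Matrix.mul_apply, ofReal_elemSkew]

/-! ### The two brackets as biderivations and their values on coordinates. -/

/-- The paths in `so(n)*` along the coordinate directions. -/
def skewPath (n : ℕ) (a : Fin n × Fin n) (l : SkewMat n) (t : ℝ) : SkewMat n := shiftSkew a t l

/-- The paths in `T*SO(p)` along the momentum and rotation directions. -/
noncomputable def cotangentPath (p : ℕ) :
    (Fin p × Fin p) ⊕ (Fin p × Fin p) → CotangentSO p → ℝ → CotangentSO p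
  | Sum.inl a, x, t => (x.1, shiftSkew a t x.2)
  | Sum.inr a, x, t => (x.1 * rotation a t, x.2)

theorem isBiderivationOn_skewBracket (n : ℕ) :
    IsBiderivationOn (skewBracket (n := n)) (pathAlgebra (skewPath n)) :=
  isBiderivationOn_pathAlgebra (skewPath n) (fun a l => shiftSkew_zero a l) (pairs n)
    (fun a b l => (lieBracketCoord l.1 a b : ℂ)) fun a b l => by
      rw [lieBracketCoord_symm l.apply_eq_neg, Complex.ofReal_neg]

/-- The Poisson tensor of `T*SO(p)` in the left trivialization. -/
noncomputable def cotangentTensor (p : ℕ) :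
    (Fin p × Fin p) ⊕ (Fin p × Fin p) → (Fin p × Fin p) ⊕ (Fin p × Fin p) → CotangentSO p → ℂ
  | Sum.inl a, Sum.inl b, x => (lieBracketCoord x.2.1 a b : ℂ)
  | Sum.inl a, Sum.inr b, _ => if a = b then 1 else 0
  | Sum.inr a, Sum.inl b, _ => -if a = b then 1 else 0
  | Sum.inr _, Sum.inr _, _ => 0

/-- Momentum and rotation directions are joined into one index set, so that the bracket comes from a
single antisymmetric tensor. Its mixed blocks are plus and minus the identity. -/
theorem canonicalBracket_eq {p : ℕ} (f g : CotangentSO p → ℂ) (x : CotangentSO p) :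
    canonicalBracket f g x = ∑ i ∈ (pairs p).disjSum (pairs p), ∑ j ∈ (pairs p).disjSum (pairs p),
      pathDeriv (cotangentPath p) i f x * pathDeriv (cotangentPath p) j g x
        * cotangentTensor p i j x := by
  simp only [Finset.sum_disjSum, cotangentTensor, mul_ite, mul_one, mul_zero, mul_neg,
    Finset.sum_neg_distrib, Finset.sum_ite_eq, Finset.sum_const_zero, add_zero,
    Finset.sum_add_distrib]
  rw [canonicalBracket, Finset.sum_sub_distrib, add_assoc]
  congr 1
  rw [sub_eq_add_neg, add_comm]
  congr 1
  · rw [neg_inj]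
    refine Finset.sum_congr rfl fun a ha => ?_
    rw [if_pos ha]
    rfl
  · refine Finset.sum_congr rfl fun a ha => ?_
    rw [if_pos ha]
    rfl

theorem isBiderivationOn_canonicalBracket (p : ℕ) :
    IsBiderivationOn (canonicalBracket (p := p)) (pathAlgebra (cotangentPath p)) := by
  have h : (canonicalBracket (p := p)) = _ :=
    funext fun f => funext fun g => funext fun x => canonicalBracket_eq f g x
  rw [h]
  refine isBiderivationOn_pathAlgebra (cotangentPath p) ?_ _ (cotangentTensor p) ?_
  · rintro (a | a) x
    · simp [cotangentPath, shiftSkew_zero]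
    · simp [cotangentPath, rotation_zero]
  · rintro (a | a) (b | b) x
    · simp only [cotangentTensor]
      rw [lieBracketCoord_symm x.2.apply_eq_neg, Complex.ofReal_neg]
    · simp [cotangentTensor, eq_comm]
    · simp [cotangentTensor, eq_comm]
    · simp [cotangentTensor]

theorem momentum_mem_pathAlgebra {p : ℕ} (i j : Fin p) :
    (fun x : CotangentSO p => ((x.2.1 i j : ℝ) : ℂ)) ∈ pathAlgebra (cotangentPath p) := by
  rintro (a | a) x
  · exact (hasDerivAt_shiftSkew a x.2 i j).differentiableAt
  · change DifferentiableAt ℝ (fun _ : ℝ => ((x.2.1 i j : ℝ) : ℂ)) 0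
    exact differentiableAt_const _

theorem rotation_mem_pathAlgebra {p : ℕ} (i j : Fin p) :
    (fun x : CotangentSO p => ((x.1.1 i j : ℝ) : ℂ)) ∈ pathAlgebra (cotangentPath p) := by
  rintro (a | a) x
  · change DifferentiableAt ℝ (fun _ : ℝ => ((x.1.1 i j : ℝ) : ℂ)) 0
    exact differentiableAt_const _
  · exact (hasDerivAt_mul_rotation_apply x.1 a i j).differentiableAt

theorem momentumDeriv_momentum {p : ℕ} (a : Fin p × Fin p) (i j : Fin p) (x : CotangentSO p) :
    momentumDeriv a (fun x => ((x.2.1 i j : ℝ) : ℂ)) x = elemSkew ℂ a i j :=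
  (hasDerivAt_shiftSkew a x.2 i j).deriv

theorem rotationDeriv_momentum {p : ℕ} (a : Fin p × Fin p) (i j : Fin p) (x : CotangentSO p) :
    rotationDeriv a (fun x => ((x.2.1 i j : ℝ) : ℂ)) x = 0 := by
  simp [rotationDeriv]

theorem momentumDeriv_rotation {p : ℕ} (a : Fin p × Fin p) (i j : Fin p) (x : CotangentSO p) :
    momentumDeriv a (fun x => ((x.1.1 i j : ℝ) : ℂ)) x = 0 := by
  simp [momentumDeriv]

theorem rotationDeriv_rotation {p : ℕ} (a : Fin p × Fin p) (i j : Fin p) (x : CotangentSO p) :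
    rotationDeriv a (fun x => ((x.1.1 i j : ℝ) : ℂ)) x = (cplx x.1.1 * elemSkew ℂ a) i j :=
  (hasDerivAt_mul_rotation_apply x.1 a i j).deriv

theorem canonicalBracket_momentum_momentum {p : ℕ} (i j m n : Fin p) (x : CotangentSO p) :
    canonicalBracket (fun x => ((x.2.1 i j : ℝ) : ℂ)) (fun x => ((x.2.1 m n : ℝ) : ℂ)) x
      = (lieBracketCoord x.2.1 (i, j) (m, n) : ℂ) := by
  simp only [canonicalBracket, momentumDeriv_momentum, rotationDeriv_momentum, mul_zero, zero_mul,
    sub_zero, Finset.sum_const_zero, add_zero, sum_sum_elemSkew_lieBracketCoord]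

theorem mul_elemSkew_apply {p : ℕ} (k : Matrix (Fin p) (Fin p) ℂ) (i j n m : Fin p) :
    (k * elemSkew ℂ (i, j)) n m = (1 : Matrix (Fin p) (Fin p) ℂ) j m * k n i
      - (1 : Matrix (Fin p) (Fin p) ℂ) i m * k n j := by
  simp only [Matrix.mul_apply, elemSkew_apply, mul_sub, Finset.sum_sub_distrib, Matrix.one_apply,
    mul_ite, ite_mul, mul_one, one_mul, mul_zero, zero_mul]
  simp

theorem canonicalBracket_momentum_rotation {p : ℕ} (i j n m : Fin p) (x : CotangentSO p) :
    canonicalBracket (fun x => ((x.2.1 i j : ℝ) : ℂ)) (fun x => ((x.1.1 n m : ℝ) : ℂ)) x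
      = (1 : Matrix (Fin p) (Fin p) ℂ) j m * x.1.1 n i
        - (1 : Matrix (Fin p) (Fin p) ℂ) i m * x.1.1 n j := by
  simp only [canonicalBracket, momentumDeriv_momentum, rotationDeriv_momentum,
    momentumDeriv_rotation, rotationDeriv_rotation, mul_zero, zero_mul,
    sub_zero, Finset.sum_const_zero, zero_add]
  refine (sum_pairs_elemSkew_smul (fun a => (cplx x.1.1 * elemSkew ℂ a) n m) (fun i j => ?_)
    i j).trans (mul_elemSkew_apply _ _ _ _ _)
  rw [elemSkew_swap, Matrix.mul_neg, Matrix.neg_apply]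

theorem canonicalBracket_rotation_rotation {p : ℕ} (i j m n : Fin p) (x : CotangentSO p) :
    canonicalBracket (fun x => ((x.1.1 i j : ℝ) : ℂ)) (fun x => ((x.1.1 m n : ℝ) : ℂ)) x = 0 := by
  simp only [canonicalBracket, momentumDeriv_rotation, mul_zero, zero_mul,
    sub_zero, Finset.sum_const_zero, add_zero]

theorem skew_mem_pathAlgebra {n : ℕ} (i j : Fin n) :
    (fun l : SkewMat n => ((l.1 i j : ℝ) : ℂ)) ∈ pathAlgebra (skewPath n) :=
  fun a l => (hasDerivAt_shiftSkew a l i j).differentiableAt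

theorem skewBracket_coord {p : ℕ} (i j m n : Fin p) (l : SkewMat p) :
    skewBracket (fun l => ((l.1 i j : ℝ) : ℂ)) (fun l => ((l.1 m n : ℝ) : ℂ)) l
      = (lieBracketCoord l.1 (i, j) (m, n) : ℂ) := by
  rw [← sum_sum_elemSkew_lieBracketCoord, skewBracket]
  refine Finset.sum_congr rfl fun a _ => Finset.sum_congr rfl fun b _ => ?_
  rw [(hasDerivAt_shiftSkew a l i j).deriv, (hasDerivAt_shiftSkew b l m n).deriv]

section

variable {p q : ℕ}

/-! ### The Lax matrix on `T*SO(p)` -/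

theorem cplx_mul {l m n : Type*} [Fintype m] (A : Matrix l m ℝ) (B : Matrix m n ℝ) :
    cplx (A * B) = cplx A * cplx B :=
  Matrix.map_mul (f := Complex.ofRealHom)

theorem SOGroup.cplx_mul_transpose (k : SOGroup p) : cplx k.1 * (cplx k.1)ᵀ = 1 := by
  have h := (Matrix.mem_orthogonalGroup_iff _ _).1
    ((Matrix.mem_specialOrthogonalGroup_iff.1 k.2).1)
  have h2 : cplx (k.1 * k.1ᵀ) = cplx 1 := congrArg cplx h
  rw [cplx_mul] at h2
  rw [← Matrix.transpose_map] at *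
  simpa [cplx] using h2

theorem SOGroup.cplx_transpose_mul (k : SOGroup p) : (cplx k.1)ᵀ * cplx k.1 = 1 :=
  mul_eq_one_comm.1 k.cplx_mul_transpose

theorem SkewMat.cplx_transpose (l : SkewMat p) : (cplx l.1)ᵀ = -cplx l.1 := by
  ext i j
  simp [l.apply_eq_neg j i]

/-- The body-frame vectors `u = kᵀ F`. -/
def bodyFrame (F : Matrix (Fin p) (Fin q) ℝ) (x : CotangentSO p) : Matrix (Fin p) (Fin q) ℂ :=
  (cplx x.1.1)ᵀ * cplx F

theorem bodyFrame_transpose_mul (F : Matrix (Fin p) (Fin q) ℝ) (x : CotangentSO p) :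
    (bodyFrame F x)ᵀ * bodyFrame F x = (cplx F)ᵀ * cplx F := by
  rw [bodyFrame, Matrix.transpose_mul, Matrix.transpose_transpose, Matrix.mul_assoc,
    ← Matrix.mul_assoc (cplx x.1.1), x.1.cplx_mul_transpose, Matrix.one_mul]

theorem gammaMat_transpose_mul (c : ℂ) (F : Matrix (Fin p) (Fin q) ℝ) (x : CotangentSO p) :
    (gammaMat c x)ᵀ * cplx F = (1 - c • cplx x.2.1) * bodyFrame F x := by
  rw [gammaMat, bodyFrame, Matrix.transpose_mul, Matrix.mul_assoc]
  simp

theorem transpose_mul_gammaMat (c : ℂ) (F : Matrix (Fin p) (Fin q) ℝ) (x : CotangentSO p) :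
    (cplx F)ᵀ * gammaMat c x = ((1 - c • cplx x.2.1) * bodyFrame F x)ᵀ := by
  rw [← gammaMat_transpose_mul, Matrix.transpose_mul, Matrix.transpose_transpose]

theorem transpose_mul_dMat_mul (F : Matrix (Fin p) (Fin q) ℝ) (x : CotangentSO p) :
    (cplx F)ᵀ * dMat x * cplx F = (bodyFrame F x)ᵀ * cplx x.2.1 * bodyFrame F x := by
  rw [dMat, bodyFrame, Matrix.transpose_mul, Matrix.transpose_transpose]
  simp only [Matrix.mul_assoc]

theorem laxHat_eq (c : ℂ) (F : Matrix (Fin p) (Fin q) ℝ) (lam : ℂ) (x : CotangentSO p) :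
    laxHat c F lam x = (dressing p ((cplx F)ᵀ * cplx F) (c ^ 2 / lam ^ 2))⁻¹
      * laxNumerator c (cplx x.2.1) ((1 - c • cplx x.2.1) * bodyFrame F x)
        ((bodyFrame F x)ᵀ * cplx x.2.1 * bodyFrame F x) lam := by
  rw [laxHat, gammaMat_transpose_mul, transpose_mul_gammaMat, transpose_mul_dMat_mul]
  rfl

/-- The columns of `u = kᵀ F` are fixed combinations of the rows of `k`. These rows commute with
each other and transform as vectors under `ℓ`, and orthogonality of `k` makes `uᵀ u` constant; this
is the input of `isTopAlgebra_of_semidirect`. -/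
theorem isTopAlgebra_cotangent (c : ℂ) (F : Matrix (Fin p) (Fin q) ℝ) :
    IsTopAlgebra canonicalBracket (pathAlgebra (cotangentPath p)) c ((cplx F)ᵀ * cplx F)
      (fun x => cplx x.2.1) (fun x => (1 - c • cplx x.2.1) * bodyFrame F x)
      (fun x => (bodyFrame F x)ᵀ * cplx x.2.1 * bodyFrame F x) := by
  have hb := isBiderivationOn_canonicalBracket p
  have u_eq (x : CotangentSO p) (m a) :
      bodyFrame F x m a = ∑ n, (F n a : ℂ) * ((x.1.1 n m : ℝ) : ℂ) := by
    simp [bodyFrame, Matrix.mul_apply, mul_comm]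
  have hFk (n m : Fin p) (a : Fin q) := const_mul_mem_fun (F n a : ℂ)
    (rotation_mem_pathAlgebra n m)
  have hu (m a) : (fun x : CotangentSO p => bodyFrame F x m a) ∈ pathAlgebra (cotangentPath p) := by
    simp only [u_eq]
    exact sum_mem_fun _ fun n => hFk n m a
  have lu (x : CotangentSO p) (i j m a) :
      canonicalBracket (fun y => ((y.2.1 i j : ℝ) : ℂ)) (fun y => bodyFrame F y m a) x
        = (1 : Matrix (Fin p) (Fin p) ℂ) j m * bodyFrame F x i a
          - (1 : Matrix (Fin p) (Fin p) ℂ) i m * bodyFrame F x j a := by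
    simp only [u_eq]
    rw [hb.sum_right x _ (momentum_mem_pathAlgebra i j) (hFk · m a)]
    simp only [Finset.mul_sum, ← Finset.sum_sub_distrib]
    refine Finset.sum_congr rfl fun n _ => ?_
    rw [hb.const_mul_right x _ (momentum_mem_pathAlgebra i j) (rotation_mem_pathAlgebra n m),
      canonicalBracket_momentum_rotation]
    ring
  have uu (x : CotangentSO p) (i a j b) :
      canonicalBracket (fun y => bodyFrame F y i a) (fun y => bodyFrame F y j b) x = 0 := by
    simp only [u_eq]
    rw [hb.sum_left x _ (hFk · i a) (sum_mem_fun _ (hFk · j b))]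
    refine Finset.sum_eq_zero fun n _ => ?_
    rw [hb.sum_right x _ (hFk n i a) (hFk · j b)]
    refine Finset.sum_eq_zero fun m _ => ?_
    rw [hb.const_mul_left x _ (rotation_mem_pathAlgebra n i) (hFk m j b),
      hb.const_mul_right x _ (rotation_mem_pathAlgebra n i) (rotation_mem_pathAlgebra m j),
      canonicalBracket_rotation_rotation]
    simp
  refine isTopAlgebra_of_semidirect hb c momentum_mem_pathAlgebra hu
    (fun x i j => ?_) (fun x a b => ?_) (fun a b => ?_) (fun x i j m n => ?_) lu uu
  · simp [x.2.apply_eq_neg i j]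
  · rw [← bodyFrame_transpose_mul F x, Matrix.mul_apply]
    rfl
  · simp [Matrix.mul_apply, mul_comm]
  · exact (canonicalBracket_momentum_momentum i j m n x).trans (ofReal_lieBracketCoord i j m n)

theorem IsTopAlgebra.rMatrixRelation {X : Type*} {pb : (X → ℂ) → (X → ℂ) → X → ℂ}
    {S : Subalgebra ℂ (X → ℂ)} {c : ℂ} {F : Matrix (Fin p) (Fin q) ℝ}
    {l : X → Matrix (Fin p) (Fin p) ℂ} {v : X → Matrix (Fin p) (Fin q) ℂ}
    {w : X → Matrix (Fin q) (Fin q) ℂ} (ht : IsTopAlgebra pb S c ((cplx F)ᵀ * cplx F) l v w)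
    (hqp : q ≤ p) :
    RMatrixRelation pb (fun lam x => (dressing p ((cplx F)ᵀ * cplx F) (c ^ 2 / lam ^ 2))⁻¹
        * laxNumerator c (l x) (v x) (w x) lam) (fun lam mu => -rHat c F lam mu)
      (regularPoints c F) :=
  rMatrixRelation_of_dressed ht.bider (fun _ h => h.2)
    (fun lam => ht.laxNumerator_mem hqp lam)
    fun _ hlam _ hmu hne x a b e d => ht.bracket_laxNumerator hqp hlam.1 hmu.1 hne x a b e d

/-! ### The gauge transformation -/

/-- By the Schur complement of the upper left identity block, both determinants equal `det (1 + c²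
λ⁻² Fᵀ F)`. -/
theorem isUnit_det_one_sub_yMat (c : ℂ) (F : Matrix (Fin p) (Fin q) ℝ) {lam : ℂ}
    (hlam : lam ∈ regularPoints c F) : IsUnit (1 - lam⁻¹ • yMat c (cplx F)).det := by
  have h1 : (1 - lam⁻¹ • yMat c (cplx F))
      = Matrix.fromBlocks 1 (-((lam⁻¹ * c) • cplx F)) ((lam⁻¹ * c) • (cplx F)ᵀ) 1 := by
    rw [yMat]
    ext (i | i) (j | j) <;> simp [mul_assoc, Matrix.one_apply]
  have h2 : 1 + (c ^ 2 / lam ^ 2) • hMat F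
      = Matrix.fromBlocks 1 0 0 (1 + (c ^ 2 / lam ^ 2) • ((cplx F)ᵀ * cplx F)) := by
    rw [hMat]
    ext (i | i) (j | j) <;> simp [Matrix.one_apply]
  have h3 := hlam.2
  rw [h2, Matrix.det_fromBlocks_zero₁₂, Matrix.det_one, one_mul] at h3
  rw [h1, Matrix.det_fromBlocks_one₁₁]
  convert h3 using 3
  rw [Matrix.mul_neg, sub_neg_eq_add, Matrix.smul_mul, Matrix.mul_smul, smul_smul]
  congr 2
  field_simp

/-- The factorization `B H A` is the block LDU decomposition of `Gᵀ Y G`, whose off-diagonal blocks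
are `-s u` and `s uᵀ` with `s = c λ⁻¹`. The same `B` and `A` relate `N` to `Gᵀ W G`, so `B` cancels
in the quotient and the final conjugation removes `A`. -/
theorem reducedGaugeTransform_eq (c : ℂ) (F : Matrix (Fin p) (Fin q) ℝ) {lam : ℂ}
    (hlam : lam ∈ regularPoints c F) (x : CotangentSO p) :
    reducedGaugeTransform c F lam x = laxHat c F lam x := by
  have hy := isUnit_det_one_sub_yMat c F hlam
  have hH : IsUnit (dressing p ((cplx F)ᵀ * cplx F) (c ^ 2 / lam ^ 2)).det := hlam.2
  rw [laxHat_eq, reducedGaugeTransform, gaugeTransform, laxY2]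
  set k := cplx x.1.1 with hk
  set l := cplx x.2.1 with hl
  set u := bodyFrame F x with hu
  set E := truncId p q with hE
  set Fc := cplx F with hFc
  set s := lam⁻¹ * c with hs
  have hkk : k * kᵀ = 1 := x.1.cplx_mul_transpose
  have hkk' : kᵀ * k = 1 := x.1.cplx_transpose_mul
  have huF : k * u = Fc := by
    rw [hu, bodyFrame, ← Matrix.mul_assoc, hkk, Matrix.one_mul]
  have hh : Fcᵀ * Fc = uᵀ * u := (bodyFrame_transpose_mul F x).symm
  set H := dressing p (Fcᵀ * Fc) (c ^ 2 / lam ^ 2) with hHdef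
  set N := laxNumerator c l ((1 - c • l) * u) (uᵀ * l * u) lam with hN
  set G : Matrix (Fin p ⊕ Fin q) (Fin p ⊕ Fin q) ℂ := Matrix.fromBlocks k 0 0 1 with hG
  set Y := (1 - lam⁻¹ • yMat c Fc) with hY
  set W := laxIn E Fc k l 1 (-(Eᵀ * l * E)) lam
    - c • Matrix.fromBlocks 0 0 0 
      ((1 : Matrix (Fin q) (Fin q) ℂ) * Eᵀ * kᵀ * Fc
        - Fcᵀ * k * E * (1 : Matrix (Fin q) (Fin q) ℂ)ᵀ) with hW
  have hA : 1 - lam⁻¹ • c • Matrix.fromBlocks (0 : Matrix (Fin p) (Fin p) ℂ) (kᵀ * Fc)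
      (0 : Matrix (Fin q) (Fin p) ℂ) 0 = Matrix.fromBlocks 1 (-(s • u)) 0 1 := by
    ext (i | i) (j | j) <;> simp [hs, hu, bodyFrame, hk, hFc, mul_assoc, Matrix.one_apply]
  rw [hA]
  set A : Matrix (Fin p ⊕ Fin q) (Fin p ⊕ Fin q) ℂ := Matrix.fromBlocks 1 (-(s • u)) 0 1 with hAdef
  have hAdet : IsUnit A.det := by simp [hAdef]
  have hGG : Gᵀ * G = 1 := by
    simp [hG, Matrix.fromBlocks_transpose, Matrix.fromBlocks_multiply, hkk']
  have hs2 : c ^ 2 / lam ^ 2 = s * s := by rw [hs]; field_simp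
  have hYeq : Y = Matrix.fromBlocks 1 (-(s • Fc)) (s • Fcᵀ) 1 := by
    rw [hY, yMat]
    ext (i | i) (j | j) <;> simp [mul_assoc, hs, Matrix.one_apply]
  have hHeq : H = Matrix.fromBlocks 1 0 0 (1 + (s * s) • (uᵀ * u)) := by
    rw [hHdef, dressing, hs2, hh]
    ext (i | i) (j | j) <;> simp [Matrix.one_apply]
  -- `B` satisfies `Y G = G B H A` and `W G = G B N A`.
  set B : Matrix (Fin p ⊕ Fin q) (Fin p ⊕ Fin q) ℂ := Matrix.fromBlocks 1 0 (s • uᵀ) 1 with hB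
  have h1 : Y * G = G * B * H * A := by
    rw [hYeq, hG, hB, hHeq, hAdef]
    simp only [Matrix.fromBlocks_multiply, Matrix.mul_one, Matrix.one_mul, Matrix.mul_zero,
      Matrix.zero_mul, add_zero, zero_add]
    rw [← huF, Matrix.transpose_mul]
    congr 1
    · simp
    · rw [Matrix.smul_mul, Matrix.mul_assoc, hkk', Matrix.mul_one]
    · simp [Matrix.smul_mul, smul_smul]
  have hlam0 : lam ≠ 0 := hlam.1
  have hls : lᵀ = -l := x.2.cplx_transpose
  -- Multiplication by `A` cancels `c ℓ u` in the upper right block. In the lower right block it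
  -- cancels `c² λ⁻² w`, using `vᵀ = uᵀ (1 + c ℓ)`.
  have hNA : N * A = Matrix.fromBlocks (-l) (lam • E + lam⁻¹ • u)
      (lam • Eᵀ + lam⁻¹ • (uᵀ + c • (uᵀ * l)))
      (Eᵀ * l * E - c • (Eᵀ * u) - (s * lam⁻¹) • (uᵀ * u)) := by
    rw [hN, laxNumerator, hAdef, hs2]
    simp only [Matrix.fromBlocks_smul, Matrix.fromBlocks_add, sub_eq_add_neg,
      Matrix.fromBlocks_neg, Matrix.fromBlocks_multiply, Matrix.transpose_mul,
      Matrix.transpose_add, Matrix.transpose_neg, Matrix.transpose_smul, hls,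
      Matrix.add_mul, Matrix.mul_neg, Matrix.neg_mul, Matrix.mul_smul,
      Matrix.smul_mul, Matrix.mul_one, Matrix.one_mul, Matrix.mul_zero,
      smul_zero, neg_zero, add_zero, zero_add, Matrix.mul_assoc, hs]
    congr 1
    · module
    · module
    · match_scalars <;> field_simp ; ring
  -- Multiplication by `B` removes the remaining `c uᵀ ℓ` and `uᵀ u`, and produces the term `c uᵀ E`
  -- of the correction in `L_y^{(2)}`.
  have hBNA : B * (N * A) = Matrix.fromBlocks (-l) (lam • E + lam⁻¹ • u)
      (lam • Eᵀ + lam⁻¹ • uᵀ) (Eᵀ * l * E - c • (Eᵀ * u - uᵀ * E)) := by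
    rw [hNA, hB]
    simp only [Matrix.fromBlocks_multiply, Matrix.mul_add, Matrix.mul_neg, Matrix.mul_smul,
      Matrix.smul_mul, Matrix.one_mul, Matrix.zero_mul, add_zero, Matrix.mul_assoc,
      hs]
    congr 1
    · module
    · module
    · rw [smul_smul lam, mul_inv_cancel_left₀ hlam0]
      module
  have h2 : W * G = G * B * N * A := by
    rw [Matrix.mul_assoc _ N, Matrix.mul_assoc, hBNA, hW, laxIn, hG, ← huF, Matrix.transpose_mul]
    simp only [Matrix.fromBlocks_smul, Matrix.fromBlocks_add, sub_eq_add_neg,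
      Matrix.fromBlocks_neg, Matrix.fromBlocks_multiply, Matrix.transpose_one,
      Matrix.mul_add, Matrix.add_mul, Matrix.mul_neg, Matrix.neg_mul, Matrix.mul_smul,
      Matrix.smul_mul, Matrix.mul_one, Matrix.one_mul, Matrix.mul_zero, Matrix.zero_mul,
      smul_zero, neg_zero, add_zero, zero_add, Matrix.mul_assoc, hkk', neg_neg]
    simp only [← Matrix.mul_assoc kᵀ k, hkk', Matrix.one_mul]
  have h3 : Y⁻¹ * (W * G) = G * (A⁻¹ * (H⁻¹ * (N * A))) := by
    have h4 : W * G = Y * (G * (A⁻¹ * (H⁻¹ * (N * A)))) := by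
      rw [h2, ← Matrix.mul_assoc Y, h1]
      simp only [Matrix.mul_assoc]
      rw [Matrix.mul_nonsing_inv_cancel_left _ _ hAdet, Matrix.mul_nonsing_inv_cancel_left _ _ hH]
    rw [h4, Matrix.nonsing_inv_mul_cancel_left _ _ hy]
  calc A * (Gᵀ * (Y⁻¹ * W) * G) * A⁻¹ = A * (Gᵀ * (Y⁻¹ * (W * G))) * A⁻¹ := by
        simp only [Matrix.mul_assoc]
    _ = A * (Gᵀ * G * (A⁻¹ * (H⁻¹ * (N * A)))) * A⁻¹ := by rw [h3, Matrix.mul_assoc Gᵀ G]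
    _ = H⁻¹ * N * (A * A⁻¹) := by
        rw [hGG, Matrix.one_mul, Matrix.mul_nonsing_inv_cancel_left _ _ hAdet]
        simp only [Matrix.mul_assoc]
    _ = H⁻¹ * N := by rw [Matrix.mul_nonsing_inv _ hAdet, Matrix.mul_one]

end

/-! ### The tops on `so(4)` -/

/-- The indices `i + 1`, `i + 2` are taken modulo 3, so `(i, i + 1, i + 2)` is always a cyclic
permutation. -/
theorem sum_levi_skew {l : Matrix (Fin 3) (Fin 3) ℂ} (hl : ∀ i j, l i j = -l j i) (i : Fin 3) :
    -(1 / 2) * ∑ j, ∑ k, levi i j k * l j k = -l (i + 1) (i + 2) := by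
  fin_cases i
  · simp [levi, Fin.sum_univ_three, hl 2 1]
    ring
  · simp [levi, Fin.sum_univ_three, hl 2 0]
    ring
  · simp [levi, Fin.sum_univ_three, hl 1 0]
    ring

theorem levi_sum_skew {l : Matrix (Fin 3) (Fin 3) ℂ} (hl : ∀ i j, l i j = -l j i) (j k : Fin 3) :
    -∑ i : Fin 3, levi i j k * -l (i + 1) (i + 2) = l j k := by
  have hd (i) : l i i = 0 := by linear_combination (hl i i) / 2
  fin_cases j <;> fin_cases k <;>
    simp [levi, Fin.sum_univ_three, hd, hl 2 1, hl 1 0, hl 2 0] <;> norm_num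

/-- For a single column `a` the scalar `w_{aa}` vanishes by skew symmetry, so `{v, v}` reduces to
`c² ℓ`, which is `-c² ε J` since `ℓ_{ij} = -ε_{ijk} J_k`. -/
theorem IsTopAlgebra.so4Relations {X : Type*} {q : ℕ} {pb : (X → ℂ) → (X → ℂ) → X → ℂ}
    {S : Subalgebra ℂ (X → ℂ)} {c : ℂ} {h : Matrix (Fin q) (Fin q) ℂ}
    {l : X → Matrix (Fin 3) (Fin 3) ℂ} {v : X → Matrix (Fin 3) (Fin q) ℂ}
    {w : X → Matrix (Fin q) (Fin q) ℂ} (ht : IsTopAlgebra pb S c h l v w) (a : Fin q)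
    (ha : h a a = 1) :
    SO4Relations pb (-c ^ 2) (fun x i => -(1 / 2) * ∑ j, ∑ k, levi i j k * l x j k)
      (fun x i => v x i a) := by
  intro i j x
  have hw : w x a a = 0 := by linear_combination (ht.w_skew x a a) / 2
  have hd (i) : l x i i = 0 := by linear_combination (ht.l_skew x i i) / 2
  have hl := ht.l_skew x
  simp only [sum_levi_skew (ht.l_skew _)]
  refine ⟨?_, ?_, ?_⟩
  · rw [ht.bider.neg_left x (ht.l_mem _ _) (neg_mem_fun (ht.l_mem _ _)),
      ht.bider.neg_right x (ht.l_mem _ _) (ht.l_mem _ _), ht.ll]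
    fin_cases i <;> fin_cases j <;>
      simp [levi, Fin.sum_univ_three, hd, hl 2 1, hl 1 0, hl 2 0, Matrix.one_apply] <;>
      norm_num
  · rw [ht.bider.neg_left x (ht.l_mem _ _) (ht.v_mem _ _), ht.lv]
    fin_cases i <;> fin_cases j <;>
      simp [levi, Fin.sum_univ_three, Matrix.one_apply] <;> norm_num
  · rw [ht.vv, ha, hw, mul_zero, sub_zero, mul_one, ← levi_sum_skew hl i j]
    fin_cases i <;> fin_cases j <;> simp [levi, Fin.sum_univ_three, hl 2 0] <;> norm_num

theorem cornerMat_transpose_mul_apply (q : ℕ) (a b : Fin q) :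
    ((cplx (cornerMat q))ᵀ * cplx (cornerMat q)) a b
      = if a.val = 0 ∧ b.val = 0 then 1 else 0 := by
  simp only [Matrix.mul_apply, Fin.sum_univ_three, cornerMat, Matrix.transpose_apply,
    Matrix.map_apply, Matrix.of_apply]
  by_cases ha : a.val = 0 <;> by_cases hb : b.val = 0 <;> simp [ha, hb]

theorem topLax_eq (q : ℕ) (c lam : ℂ) {l : Matrix (Fin 3) (Fin 3) ℂ} (hl : ∀ i j, l i j = -l j i)
    {J : Fin 3 → ℂ} (hJ : ∀ i, J i = -(1 / 2) * ∑ j, ∑ k, levi i j k * l j k) (y : Fin 3 → ℂ) :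
    topLax q c lam J y
      = (dressing 3 ((cplx (cornerMat q))ᵀ * cplx (cornerMat q)) (c ^ 2 / lam ^ 2))⁻¹
        * laxNumerator c l (Matrix.of fun i j => if j.val = 0 then y i else 0) 0 lam := by
  have h1 : (Matrix.of fun j k => -∑ i, levi i j k * J i) = l := by
    ext j k
    simp only [Matrix.of_apply, hJ, sum_levi_skew hl]
    exact levi_sum_skew hl j k
  have h2 : Matrix.fromBlocks (0 : Matrix (Fin 3) (Fin 3) ℂ) 0 0 (0 : Matrix (Fin q) (Fin q) ℂ)
      = 0 := Matrix.fromBlocks_zero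
  rw [topLax, laxNumerator, h2, smul_zero, add_zero]
  simp only [h1]
  rfl

theorem bodyY_eq {q : ℕ} (a : Fin q) (ha : a.val = 0) (c : ℂ) (x : CotangentSO 3) (i : Fin 3) :
    bodyY c x i = ((1 - c • cplx x.2.1) * bodyFrame (cornerMat q) x : Matrix (Fin 3) (Fin q) ℂ) i a := by
  rw [← gammaMat_transpose_mul]
  simp [Matrix.mul_apply, Fin.sum_univ_three, cornerMat, ha, bodyY]

theorem so4Relations_canonicalBracket (c : ℂ) :
    SO4Relations canonicalBracket (-c ^ 2) bodyJ (bodyY c) := by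
  -- The functions `J` and `y` do not involve `q`, so the case `q = 1` suffices.
  have h := (isTopAlgebra_cotangent c (cornerMat 1)).so4Relations 0
    (by simp [cornerMat_transpose_mul_apply])
  have hy : bodyY c = fun x i =>
      ((1 - c • cplx x.2.1) * bodyFrame (cornerMat 1) x : Matrix (Fin 3) (Fin 1) ℂ) i 0 := by
    ext x i
    exact bodyY_eq (0 : Fin 1) rfl c x i
  rw [hy]
  exact h

theorem laxHat_eq_topLax (q : ℕ) (c lam : ℂ) (x : CotangentSO 3) :
    laxHat c (cornerMat q) lam x = topLax q c lam (bodyJ x) (bodyY c x) := by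
  have hl (i j) : cplx x.2.1 i j = -cplx x.2.1 j i := by simp [x.2.apply_eq_neg i j]
  have ht := isTopAlgebra_cotangent c (cornerMat q)
  rw [laxHat_eq, topLax_eq q c lam hl (J := bodyJ x) (fun i => rfl)]
  have hv : (1 - c • cplx x.2.1) * bodyFrame (cornerMat q) x
      = Matrix.of fun i j => if j.val = 0 then bodyY c x i else 0 := by
    ext i j
    simp only [Matrix.of_apply]
    split_ifs with hj
    · rw [bodyY_eq j hj]
    · rw [← gammaMat_transpose_mul]
      simp [Matrix.mul_apply, cornerMat, hj]
  -- For the corner matrix only the upper left entry of `w` could be nonzero, and it is a diagonal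
  -- entry of a skew matrix.
  have hw : (bodyFrame (cornerMat q) x)ᵀ * cplx x.2.1 * bodyFrame (cornerMat q) x = 0 := by
    ext a b
    by_cases ha : a.val = 0 ∧ b.val = 0
    · obtain rfl : a = b := Fin.ext (ha.1.trans ha.2.symm)
      exact self_eq_neg.1 (ht.w_skew x a a)
    · rw [← transpose_mul_dMat_mul]
      by_cases ha' : a.val = 0
      · have hb : b.val ≠ 0 := fun hb => ha ⟨ha', hb⟩
        simp [Matrix.mul_apply, cornerMat, hb]
      · simp [Matrix.mul_apply, cornerMat, ha']
  rw [hv, hw]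

/-- The vector variables of the tops on `so(4)*`. -/
theorem isTopAlgebra_skewBracket (q : ℕ) {c kappa : ℂ} (hk : kappa ^ 2 = -c ^ 2) :
    IsTopAlgebra skewBracket (pathAlgebra (skewPath 4)) c
      ((cplx (cornerMat q))ᵀ * cplx (cornerMat q))
      (fun M => Matrix.of fun i j : Fin 3 => ((M.1 i.castSucc j.castSucc : ℝ) : ℂ))
      (fun M => Matrix.of fun (i : Fin 3) (j : Fin q) => if j.val = 0 then so4Y kappa M i else 0)
      (fun _ => 0) := by
  have hb := isBiderivationOn_skewBracket 4
  have hone (i j : Fin 3) : (1 : Matrix (Fin 4) (Fin 4) ℂ) i.castSucc j.castSucc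
      = (1 : Matrix (Fin 3) (Fin 3) ℂ) i j := by simp [Matrix.one_apply]
  have hlast (i : Fin 3) : (1 : Matrix (Fin 4) (Fin 4) ℂ) i.castSucc (Fin.last 3) = 0 := by
    rw [Matrix.one_apply_ne (Fin.castSucc_lt_last i).ne]
  have hlast' (i : Fin 3) : (1 : Matrix (Fin 4) (Fin 4) ℂ) (Fin.last 3) i.castSucc = 0 := by
    rw [one_apply_comm, hlast]
  have hy (i : Fin 3) : (fun M => so4Y kappa M i) ∈ pathAlgebra (skewPath 4) :=
    const_mul_mem_fun kappa (skew_mem_pathAlgebra _ _)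
  have hskew (M : SkewMat 4) (i j) : ((M.1 i j : ℝ) : ℂ) = -((M.1 j i : ℝ) : ℂ) := by
    rw [M.apply_eq_neg, Complex.ofReal_neg]
  refine ⟨hb, ?_, ?_, ?_, ?_, ?_, ?_, ?_, ?_, ?_, ?_, ?_, ?_⟩
  · intro a b
    simp only [cornerMat_transpose_mul_apply, and_comm]
  · intro i j
    exact skew_mem_pathAlgebra _ _
  · intro i j
    simp only [Matrix.of_apply]
    split_ifs
    · exact hy i
    · exact const_mem_fun _ 0
  · intro i j
    exact const_mem_fun _ 0
  · intro M i j
    exact hskew M _ _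
  · simp
  · intro M i j m n
    simp only [Matrix.of_apply]
    rw [skewBracket_coord, ofReal_lieBracketCoord]
    simp only [hone]
  · intro M i j m a
    simp only [Matrix.of_apply]
    split_ifs
    · simp only [so4Y]
      rw [hb.const_mul_right M kappa (skew_mem_pathAlgebra _ _) (skew_mem_pathAlgebra _ _),
        skewBracket_coord, ofReal_lieBracketCoord]
      simp only [hone, hlast]
      ring
    · rw [hb.const_right M 0 (skew_mem_pathAlgebra _ _)]
      simp
  · intro M i j a b
    exact hb.const_right M 0 (skew_mem_pathAlgebra _ _)
  · intro M i a j b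
    simp only [Matrix.of_apply, cornerMat_transpose_mul_apply]
    by_cases ha : a.val = 0
    · by_cases hb' : b.val = 0
      -- Since `{M_{i4}, M_{j4}} = -M_{ij}`, the factor `κ² = -c²` gives exactly the required `c²
      -- ℓ_{ij}`.
      · simp only [ha, hb', if_true, and_self, so4Y]
        rw [hb.const_mul_right M kappa (const_mul_mem_fun kappa (skew_mem_pathAlgebra _ _))
            (skew_mem_pathAlgebra _ _),
          hb.const_mul_left M kappa (skew_mem_pathAlgebra _ _) (skew_mem_pathAlgebra _ _),
          skewBracket_coord, ofReal_lieBracketCoord]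
        simp only [hone, hlast, hlast', Matrix.one_apply_eq, Matrix.zero_apply]
        have h0 : ((M.1 (Fin.last 3) (Fin.last 3) : ℝ) : ℂ) = 0 := by
          linear_combination hskew M (Fin.last 3) (Fin.last 3) / 2
        rw [h0]
        linear_combination (-((M.1 i.castSucc j.castSucc : ℝ) : ℂ)) * hk
      · simp only [ha, hb', if_true, if_false, and_false]
        rw [hb.const_right M 0 (hy i)]
        simp
    · simp only [ha, if_false, false_and]
      have hg : (fun M => if b.val = 0 then so4Y kappa M j else 0) ∈ pathAlgebra (skewPath 4) := by
        split_ifs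
        · exact hy j
        · exact const_mem_fun _ 0
      rw [hb.const_left 0 _ hg]
      simp
  · intro M i a b e
    have hg : (fun M => (Matrix.of fun (i : Fin 3) (j : Fin q) =>
        if j.val = 0 then so4Y kappa M i else 0) i a) ∈ pathAlgebra (skewPath 4) := by
      simp only [Matrix.of_apply]
      split_ifs
      · exact hy i
      · exact const_mem_fun _ 0
    have := hb.const_right M 0 hg
    simp only [Matrix.zero_apply]
    rw [this]
    simp only [Matrix.of_apply, cornerMat_transpose_mul_apply]
    -- The choice `w = 0` is consistent: a term on the right is nonzero only if all three column
    -- indices are the first one, and then the two terms cancel.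
    by_cases ha : a.val = 0 <;> by_cases hb' : b.val = 0 <;> by_cases he : e.val = 0 <;>
      simp [ha, hb', he]
  · intro M a b d e
    simp only [Matrix.zero_apply]
    rw [hb.const_right M 0 (const_mem_fun _ 0)]
    simp

theorem so4Relations_skewBracket {c kappa : ℂ} (hk : kappa ^ 2 = -c ^ 2) :
    SO4Relations skewBracket (-c ^ 2) so4J (so4Y kappa) :=
  (isTopAlgebra_skewBracket 1 hk).so4Relations 0 (by simp [cornerMat_transpose_mul_apply])

theorem rMatrixRelation_topLax {q : ℕ} (hq : q ≤ 3) {c kappa : ℂ} (hk : kappa ^ 2 = -c ^ 2) :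
    RMatrixRelation skewBracket (fun lam M => topLax q c lam (so4J M) (so4Y kappa M))
      (fun lam mu => -rHat c (cornerMat q) lam mu) (regularPoints c (cornerMat q)) := by
  have ht := isTopAlgebra_skewBracket q hk
  have h := ht.rMatrixRelation hq
  have hL (lam : ℂ) (M : SkewMat 4) :=
    topLax_eq q c lam (ht.l_skew M) (J := so4J M) (fun i => rfl) (so4Y kappa M)
  simp only [hL]
  exact h

/-! ### The Hamiltonians -/

theorem dressing_cornerMat_inv (q : ℕ) {s : ℂ} (hs : 1 + s ≠ 0) :
    (dressing 3 ((cplx (cornerMat q))ᵀ * cplx (cornerMat q)) s)⁻¹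
      = Matrix.diagonal (Sum.elim (fun _ => 1) fun a => if a.val = 0 then (1 + s)⁻¹ else 1) := by
  have h : dressing 3 ((cplx (cornerMat q))ᵀ * cplx (cornerMat q)) s
      = Matrix.diagonal (Sum.elim (fun _ => 1) fun a => if a.val = 0 then 1 + s else 1) := by
    ext (i | i) (j | j)
    · simp [dressing_inl_inl, Matrix.diagonal_apply, Matrix.one_apply]
    · simp [dressing_inl_inr]
    · simp [dressing_inr_inl]
    · rw [dressing_inr_inr, cornerMat_transpose_mul_apply]
      by_cases hij : i = j
      · subst hij
        by_cases hi : i.val = 0 <;> simp [hi]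
      · have : ¬(i.val = 0 ∧ j.val = 0) := fun h => hij (Fin.ext (h.1.trans h.2.symm))
        simp [hij, this]
  rw [h]
  refine Matrix.inv_eq_right_inv ?_
  rw [Matrix.diagonal_mul_diagonal, ← Matrix.diagonal_one]
  congr 1
  ext (i | i)
  · simp
  · by_cases hi : i.val = 0 <;> simp [hi, hs]

theorem tendsto_dressed_expression (c A B C D : ℂ) :
    Filter.Tendsto (fun lam : ℂ => A + (1 + c ^ 2 / lam ^ 2)⁻¹ * (B + (lam⁻¹) ^ 2 * C - D - c ^ 2))
      (Bornology.cobounded ℂ) (𝓝 (A + B - D - c ^ 2)) := by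
  have hz : Filter.Tendsto (fun lam : ℂ => (lam⁻¹) ^ 2) (Bornology.cobounded ℂ) (𝓝 0) := by
    simpa using (Filter.tendsto_inv₀_cobounded (α := ℂ)).pow 2
  have hd : Filter.Tendsto (fun lam : ℂ => (1 + c ^ 2 / lam ^ 2)⁻¹) (Bornology.cobounded ℂ)
      (𝓝 1) := by
    have h := ((hz.const_mul (c ^ 2)).const_add 1).inv₀ (by simp)
    simpa [div_eq_mul_inv] using h
  have h := (hd.mul ((((hz.mul_const C).const_add B).sub_const D).sub_const (c ^ 2))).const_add A
  convert h using 2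
  ring

theorem eventually_regular (c : ℂ) :
    ∀ᶠ lam : ℂ in Bornology.cobounded ℂ, lam ≠ 0 ∧ 1 + c ^ 2 / lam ^ 2 ≠ 0 := by
  have hz : Filter.Tendsto (fun lam : ℂ => (lam⁻¹) ^ 2) (Bornology.cobounded ℂ) (𝓝 0) := by
    simpa using (Filter.tendsto_inv₀_cobounded (α := ℂ)).pow 2
  have h := ((hz.const_mul (c ^ 2)).const_add 1).eventually_ne (b₂ := 0) (by simp)
  filter_upwards [h, Bornology.eventually_ne_cobounded (0 : ℂ)] with lam h1 h2
  exact ⟨h2, by simpa [div_eq_mul_inv] using h1⟩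

theorem trace_diagonal_mul_sq {n : Type*} [Fintype n] [DecidableEq n] (d : n → ℂ)
    (N : Matrix n n ℂ) : (Matrix.diagonal d * N * (Matrix.diagonal d * N)).trace
      = ∑ i, ∑ j, d i * N i j * (d j * N j i) := by
  refine Finset.sum_congr rfl fun i _ => ?_
  rw [Matrix.diag_apply, Matrix.mul_apply]
  simp only [Matrix.diagonal_mul]

/-- The matrix `H⁻¹` scales only the first lower row, by `η = (1 + c² λ⁻²)⁻¹`. As the diagonal of
`ℓ` vanishes, `η` enters linearly. The conditions on `q` record which `J_i` occur in the `q × q`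
block of `ℓ`; those with an entry in its first row, `J 2` and `J 1`, carry `η`, while `J 0` does
not. -/
theorem half_trace_topLax_sq {q : ℕ} (hq1 : 1 ≤ q) (hq3 : q ≤ 3) (c : ℂ) (J y : Fin 3 → ℂ) {lam : ℂ}
    (hlam : lam ≠ 0) (hs : 1 + c ^ 2 / lam ^ 2 ≠ 0) :
    (1 / 2) * (topLax q c lam J y * topLax q c lam J y).trace - (q : ℂ) * lam ^ 2
      = -(J 0 ^ 2 + J 1 ^ 2 + J 2 ^ 2) - (if q = 3 then J 0 ^ 2 else 0)
        + (1 + c ^ 2 / lam ^ 2)⁻¹ * (2 * y 0 + lam⁻¹ ^ 2 * (y 0 ^ 2 + y 1 ^ 2 + y 2 ^ 2)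
          - ((if 2 ≤ q then J 2 ^ 2 else 0) + if q = 3 then J 1 ^ 2 else 0) - c ^ 2) := by
  let l : Matrix (Fin 3) (Fin 3) ℂ := Matrix.of fun j k => -∑ i, levi i j k * J i
  have hl (i j) : l i j = -l j i := by
    fin_cases i <;> fin_cases j <;> simp [l, levi, Fin.sum_univ_three] <;> norm_num
  have hJ (i) : J i = -(1 / 2) * ∑ j, ∑ k, levi i j k * l j k := by
    rw [sum_levi_skew hl]
    fin_cases i <;> simp [l, levi, Fin.sum_univ_three] <;> norm_num
  have hJ0 : J 0 = -l 1 2 := by rw [hJ, sum_levi_skew hl]; rfl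
  have hJ1 : J 1 = -l 2 0 := by rw [hJ, sum_levi_skew hl]; rfl
  have hJ2 : J 2 = -l 0 1 := by rw [hJ, sum_levi_skew hl]; rfl
  have hd (i) : l i i = 0 := by linear_combination (hl i i) / 2
  rw [topLax_eq q c lam hl hJ y, dressing_cornerMat_inv q hs, trace_diagonal_mul_sq]
  -- This splits the one dressed term `η λ²`: with the `q - 1` undressed ones it completes `q λ²`,
  -- and the remainder `-η c²` is the source of `-c²` in the limit.
  have hη : (1 + c ^ 2 / lam ^ 2)⁻¹ * lam ^ 2 = lam ^ 2 - (1 + c ^ 2 / lam ^ 2)⁻¹ * c ^ 2 := by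
    have h1 : (1 + c ^ 2 / lam ^ 2) * lam ^ 2 = lam ^ 2 + c ^ 2 := by field_simp
    have h2 := inv_mul_cancel₀ hs
    generalize 1 + c ^ 2 / lam ^ 2 = t at *
    linear_combination lam ^ 2 * h2 - t⁻¹ * h1
  have hN1 := laxNumerator_inl_inl (p := 3) (q := q) c
  have hN2 (l) (v) (w) (lam) := laxNumerator_inl_inr c l v w lam hq3
  have hN3 (l) (v) (w) (lam) := laxNumerator_inr_inl c l v w lam hq3
  have hN4 (l) (v) (w) (lam) := laxNumerator_inr_inr c l v w lam hq3
  simp only [Fintype.sum_sum_type, hN1, hN2, hN3, hN4, Sum.elim_inl, Sum.elim_inr, hJ0, hJ1, hJ2]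
  generalize (1 + c ^ 2 / lam ^ 2)⁻¹ = η at *
  clear_value l
  have hi : lam * lam⁻¹ = 1 := mul_inv_cancel₀ hlam
  interval_cases q
  · simp [Fin.sum_univ_three, Matrix.one_apply, hd, hl 1 0, hl 2 0, hl 2 1]
    linear_combination hη + 2 * y 0 * η * hi
  · simp [Fin.sum_univ_three, Matrix.one_apply, hd, hl 1 0, hl 2 0, hl 2 1]
    linear_combination hη + 2 * y 0 * η * hi
  · simp [Fin.sum_univ_three, Matrix.one_apply, hd, hl 1 0, hl 2 0, hl 2 1]
    linear_combination hη + 2 * y 0 * η * hi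

theorem tendsto_half_trace_topLax_sq {q : ℕ} (hq1 : 1 ≤ q) (hq3 : q ≤ 3) (c : ℂ)
    (J y : Fin 3 → ℂ) :
    Filter.Tendsto
      (fun lam : ℂ =>
        (1 / 2) * (topLax q c lam J y * topLax q c lam J y).trace - (q : ℂ) * lam ^ 2)
      (Bornology.cobounded ℂ) (𝓝 (-2 * topHamiltonian q J y - c ^ 2)) := by
  have h := tendsto_dressed_expression c
    (-(J 0 ^ 2 + J 1 ^ 2 + J 2 ^ 2) - (if q = 3 then J 0 ^ 2 else 0)) (2 * y 0)
    (y 0 ^ 2 + y 1 ^ 2 + y 2 ^ 2) ((if 2 ≤ q then J 2 ^ 2 else 0) + if q = 3 then J 1 ^ 2 else 0)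
  have hlim : -2 * topHamiltonian q J y - c ^ 2
      = -(J 0 ^ 2 + J 1 ^ 2 + J 2 ^ 2) - (if q = 3 then J 0 ^ 2 else 0) + 2 * y 0
        - ((if 2 ≤ q then J 2 ^ 2 else 0) + if q = 3 then J 1 ^ 2 else 0) - c ^ 2 := by
    interval_cases q <;> simp [topHamiltonian] <;> ring
  rw [hlim]
  refine h.congr' ?_
  filter_upwards [eventually_regular c] with lam hlam
  exact (half_trace_topLax_sq hq1 hq3 c J y hlam.1 hlam.2).symm

end KowalevskiTop

theorem mainTheorem7 :
    -- the general case: the generalized Kowalevski top on `T*SO(p)`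
    (∀ (p q : ℕ) (_ : q ≤ p) (c : ℂ) (F : Matrix (Fin p) (Fin q) ℝ),
      (∀ lam ∈ regularPoints c F,
        IsUnit (1 - lam⁻¹ • yMat c (cplx F)).det ∧
        ∀ x : CotangentSO p, reducedGaugeTransform c F lam x = laxHat c F lam x) ∧
      RMatrixRelation canonicalBracket (laxHat c F) (fun lam mu => -rHat c F lam mu)
        (regularPoints c F)) ∧
    -- the Lagrange tops (`q = 1, 3`) and the Kowalevski top (`q = 2`) on `so(4)`
    (∀ (q : ℕ) (_ : 1 ≤ q) (_ : q ≤ 3) (c : ℂ),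
      SO4Relations canonicalBracket (-c ^ 2) bodyJ (bodyY c) ∧
      (∀ lam ∈ regularPoints c (cornerMat q), ∀ x : CotangentSO 3,
        laxHat c (cornerMat q) lam x = topLax q c lam (bodyJ x) (bodyY c x)) ∧
      (∀ kappa : ℂ, kappa ^ 2 = -c ^ 2 →
        SO4Relations skewBracket (-c ^ 2) so4J (so4Y kappa) ∧
        RMatrixRelation skewBracket (fun lam M => topLax q c lam (so4J M) (so4Y kappa M))
          (fun lam mu => -rHat c (cornerMat q) lam mu) (regularPoints c (cornerMat q))) ∧
      (∀ J y : Fin 3 → ℂ,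
        Filter.Tendsto
          (fun lam : ℂ =>
            (1 / 2) * (topLax q c lam J y * topLax q c lam J y).trace - (q : ℂ) * lam ^ 2)
          (Bornology.cobounded ℂ) (𝓝 (-2 * topHamiltonian q J y - c ^ 2)))) := by
  refine ⟨fun p q hqp c F => ⟨fun lam hlam => ⟨isUnit_det_one_sub_yMat c F hlam,
    fun x => reducedGaugeTransform_eq c F hlam x⟩, ?_⟩, fun q hq1 hq3 c =>
    ⟨so4Relations_canonicalBracket c, fun lam _ x => laxHat_eq_topLax q c lam x,
      fun kappa hk => ⟨so4Relations_skewBracket hk, rMatrixRelation_topLax hq3 hk⟩,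
      fun J y => tendsto_half_trace_topLax_sq hq1 hq3 c J y⟩⟩
  have h := (isTopAlgebra_cotangent c F).rMatrixRelation hqp
  simp only [← laxHat_eq] at h
  exact h
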